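/- **Conventions.** A vocabulary $\tau$ is a finite set of relation symbols of arity $\ge 1$ and constant symbols. Structures have non-empty domains; a term is a variable or a constant symbol; first-order logic includes equality. **DATALOG$^{r}$.** A DATALOG$^{r}$ program $\Pi$ is a finite set of rules $\beta\leftarrow\alpha_1,\dots,\alpha_l$ ($l\ge 0$). Each head $\beta$ is an atom $R\bar t$, where $R$ is a relation symbol, possibly zero-ary. The relation symbols that occur in the head of some rule are called intentional, all other symbols extensional. Each $\alpha_i$ is either an atomic formula (an equality, or an atom of an extensional or intentional, possibly zero-ary, relation symbol), or the negation of an equality or of an atom of an extensional symbol, or a formula $\forall\bar y\,R\bar y\bar z$ with $R$ intentional (the pairwise distinct variables $\bar y$ may occupy any positions of $R$, and the remaining positions carry terms $\bar z$). Given a structure $\mathcal A$ for the extensional symbols, let all intentional relations be empty at stage $0$, and obtain stage $i+1$ by applying all rules simultaneously to stage $i$. Let $P_{(\infty)}$ be the union of the stages of $P$, and let $\mathcal A[\Pi]$ be the expansion of $\mathcal A$ by the relations $P_{(\infty)}$. A DATALOG$^{r}$ formula over $\tau$ is $(\Pi,P)\bar t$ where $\Pi$ is a DATALOG$^{r}$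 program with set of extensional symbols $\tau$, $P$ is an intentional symbol of $\Pi$, and $\bar t$ is a tuple of variables not occurring in $\Pi$, of length the arity of $P$; it holds in $\mathcal A$ at $\bar a$ iff $\bar a\in P_{(\infty)}$. **S-DATALOG$^{r}$.** A stratified DATALOG$^{r}$ program over $\tau$ is a sequence $\Sigma=(\Pi_0,\dots,\Pi_m)$, $m\ge 0$, of DATALOG$^{r}$ programs such that the extensional symbols of $\Pi_0$ are those of $\tau$ and the extensional symbols of $\Pi_{i+1}$ are all the (extensional and intentional) symbols of $\Pi_i$. Put $\mathcal A[\Sigma]=(\dots(\mathcal A[\Pi_0])[\Pi_1]\dots)[\Pi_m]$. An S-DATALOG$^{r}$ formula is $(\Sigma,P)\bar t$ where $P$ is an intentional symbol of some $\Pi_i$; it holds in $\mathcal A$ at $\bar a$ iff $\bar a\in P^{\mathcal A[\Sigma]}$. **FO(LFP)** is the extension of first-order logic by formulas $[\mathrm{LFP}_{\bar z,Z}\,\psi]\bar t$, where the relation variable $Z$ occurs only positively in $\psi$ (and $\psi$ may have further free variables and may itself contain LFP operators), saying that $\bar t$ belongs to the least fixed point of the monotone operator $S\mapsto\{\bar b\mid\psi(\bar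 b,S)\}$. Formulas of FO(LFP) over $\tau$ have no free relation variables. **Theorem.** On finite structures, DATALOG$^{r}\equiv$ S-DATALOG$^{r}\equiv$ FO(LFP). That is, let $\tau$ be a vocabulary and $n\ge 0$. For each formula of any one of the three logics over $\tau$ with free variables among $x_1,\dots,x_n$, there is in each of the other two logics a formula over $\tau$ with free variables among $x_1,\dots,x_n$ such that the two formulas are satisfied by the same tuples $\bar a\in A^n$, for every finite $\tau$-structure $\mathcal A$ with domain $A$. (For $n=0$ this says that the two formulas have the same finite models.) -/

import Mathlib

universe u v w

namespace DatalogLFP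

/-- A vocabulary: finitely many relation symbols, all of arity at least `1`, and finitely many
constant symbols (function symbols of arity `0`); there are no other function symbols. -/
structure IsVocabulary (L : FirstOrder.Language.{u, v}) : Prop where
  finite_relations : Finite (Σ n, L.Relations n)
  finite_constants : Finite L.Constants
  no_zeroary_relations : IsEmpty (L.Relations 0)
  no_functions : ∀ n, IsEmpty (L.Functions (n + 1))

/-! ### DATALOG^r programs -/

/-- The formulas allowed in the body of a rule of a DATALOG^r program whose extensional symbols
are those of `L` and whose intentional symbols are the `P : Fin k`, of arity `ar P`.
The (first-order) variables of programs are the natural numbers. -/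
inductive Literal (L : FirstOrder.Language.{u, v}) {k : ℕ} (ar : Fin k → ℕ) : Type (max u v)
  /-- `t = s` -/
  | eq (t s : L.Term ℕ)
  /-- `¬ t = s` -/
  | neq (t s : L.Term ℕ)
  /-- `R t₁ … tₙ` with `R` extensional -/
  | rel {n : ℕ} (R : L.Relations n) (ts : Fin n → L.Term ℕ)
  /-- `¬ R t₁ … tₙ` with `R` extensional -/
  | nrel {n : ℕ} (R : L.Relations n) (ts : Fin n → L.Term ℕ)
  /-- `P t₁ … tₙ` with `P` intentional -/
  | int (P : Fin k) (ts : Fin (ar P) → L.Term ℕ)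
  /-- `∀ ȳ, P ȳ z̄` with `P` intentional. The positions that carry the (pairwise distinct)
  universally quantified variables `ȳ` are those with entry `none`; they may be any positions.
  An entry `some t` is the term `t` of `z̄` at that position. -/
  | allInt (P : Fin k) (ts : Fin (ar P) → Option (L.Term ℕ))

/-- A rule `head headArgs ← body`. -/
structure Rule (L : FirstOrder.Language.{u, v}) {k : ℕ} (ar : Fin k → ℕ) : Type (max u v) where
  head : Fin k
  headArgs : Fin (ar head) → L.Term ℕ
  body : List (Literal L ar)

/-- A DATALOG^r program with set of extensional symbols `L`. Its intentional symbols are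
`0, …, k - 1`, they may be zero-ary, and they are exactly the symbols that occur in a head. -/
structure Program (L : FirstOrder.Language.{u, v}) : Type (max u v) where
  k : ℕ
  ar : Fin k → ℕ
  rules : List (Rule L ar)
  head_surjective : ∀ P : Fin k, ∃ r ∈ rules, r.head = P

/-- An interpretation of the intentional symbols in `M`, as the set of the facts
`P a₁ … aₙ` that hold. -/
abbrev Interp {k : ℕ} (ar : Fin k → ℕ) (M : Type w) : Type w :=
  Set (Σ P : Fin k, Fin (ar P) → M)

/-- The truth of a literal, given the values `s` of the variables and the interpretation `X` of
the intentional symbols. -/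
def Literal.Holds {L : FirstOrder.Language.{u, v}} {k : ℕ} {ar : Fin k → ℕ} {M : Type w} [L.Structure M]
    (X : Interp ar M) (s : ℕ → M) : Literal L ar → Prop
  | .eq t t' => t.realize s = t'.realize s
  | .neq t t' => t.realize s ≠ t'.realize s
  | .rel R ts => FirstOrder.Language.Structure.RelMap R (fun i => (ts i).realize s)
  | .nrel R ts => ¬ FirstOrder.Language.Structure.RelMap R (fun i => (ts i).realize s)
  | .int P ts => (⟨P, fun i => (ts i).realize s⟩ : Σ P : Fin k, Fin (ar P) → M) ∈ X
  | .allInt P ts => ∀ b : Fin (ar P) → M,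
      (∀ i t, ts i = some t → b i = t.realize s) → (⟨P, b⟩ : Σ P : Fin k, Fin (ar P) → M) ∈ X

namespace Program

variable {L : FirstOrder.Language.{u, v}} (Pi : Program L) (M : Type w) [L.Structure M]

/-- One simultaneous application of all the rules. -/
def step (X : Interp Pi.ar M) : Interp Pi.ar M :=
  {f | ∃ r ∈ Pi.rules, ∃ s : ℕ → M, (∀ l ∈ r.body, l.Holds X s) ∧
    f = ⟨r.head, fun i => (r.headArgs i).realize s⟩}

/-- The stages of the intentional symbols. -/
def stage : ℕ → Interp Pi.ar M
  | 0 => ∅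
  | n + 1 => Pi.step M (stage n)

/-- The union of the stages: the values of the intentional symbols in `M[Pi]`. -/
def limit : Interp Pi.ar M := ⋃ n, Pi.stage M n

/-- The intentional symbols, as a first-order language. -/
def intLang : FirstOrder.Language.{0, 0} where
  Functions _ := Empty
  Relations n := {P : Fin Pi.k // Pi.ar P = n}

/-- The vocabulary of the program: the extensional and the intentional symbols. -/
abbrev lang : FirstOrder.Language.{u, v} := L.sum Pi.intLang

/-- The structure `M[Pi]`: the expansion of `M` by the values of the intentional symbols. -/
abbrev expansion : Pi.lang.Structure M :=
  letI : Pi.intLang.Structure M :=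
    { funMap := fun f _ => Empty.elim f
      RelMap := fun P a =>
        (⟨P.1, fun i => a (Fin.cast P.2 i)⟩ : Σ P : Fin Pi.k, Fin (Pi.ar P) → M) ∈ Pi.limit M }
  inferInstance

end Program

/-- A DATALOG^r formula `(Π, P) t̄` over `L` with free variables among `x₀, …, xₙ₋₁`. -/
structure DatalogFormula (L : FirstOrder.Language.{u, v}) (n : ℕ) : Type (max u v) where
  prog : Program L
  sym : Fin prog.k
  args : Fin (prog.ar sym) → Fin n

def DatalogFormula.Realize {L : FirstOrder.Language.{u, v}} {n : ℕ} (φ : DatalogFormula L n)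
    (M : Type w) [L.Structure M] (a : Fin n → M) : Prop :=
  (⟨φ.sym, fun i => a (φ.args i)⟩ : Σ P : Fin φ.prog.k, Fin (φ.prog.ar P) → M) ∈ φ.prog.limit M

/-! ### Stratified DATALOG^r programs -/

/-- A stratified DATALOG^r program `(Π₀, …, Πₙ)`, `n ≥ 0`, where the extensional symbols of `Π₀`
are those of `L`, and the extensional symbols of `Πₘ₊₁` are all the symbols (extensional and
intentional) of `Πₘ`. -/
inductive StratProgram : FirstOrder.Language.{u, v} → Type (max (u + 1) (v + 1))
  | single {L : FirstOrder.Language.{u, v}} (Pi : Program L) : StratProgram L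
  | cons {L : FirstOrder.Language.{u, v}} (Pi : Program L) (S : StratProgram Pi.lang) : StratProgram L

namespace StratProgram

/-- The symbols that are intentional in one of the constituents: those of the first one, and those
of the later ones. -/
inductive Sym : {L : FirstOrder.Language.{u, v}} → StratProgram L → Type (max (u + 1) (v + 1))
  | single {L : FirstOrder.Language.{u, v}} {Pi : Program L} (P : Fin Pi.k) : Sym (single Pi)
  | first {L : FirstOrder.Language.{u, v}} {Pi : Program L} {S : StratProgram Pi.lang}
      (P : Fin Pi.k) : Sym (cons Pi S)
  | later {L : FirstOrder.Language.{u, v}} {Pi : Program L} {S : StratProgram Pi.lang}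
      (P : Sym S) : Sym (cons Pi S)

/-- The arities of these symbols. -/
def Sym.ar : {L : FirstOrder.Language.{u, v}} → {S : StratProgram L} → S.Sym → ℕ
  | _, _, .single (Pi := Pi) P => Pi.ar P
  | _, _, .first (Pi := Pi) P => Pi.ar P
  | _, _, .later P => P.ar

/-- The value of an intentional symbol in `M[S] = (…(M[Π₀])[Π₁]…)[Πₙ]`. (The constituents after
the one that defines `P` do not change the value of `P`.) -/
def Sym.value : {L : FirstOrder.Language.{u, v}} → {S : StratProgram L} → (P : S.Sym) →
    (M : Type w) → [L.Structure M] → Set (Fin P.ar → M)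
  | _, _, .single (Pi := Pi) P, M, _ =>
      {a | (⟨P, a⟩ : Σ P : Fin Pi.k, Fin (Pi.ar P) → M) ∈ Pi.limit M}
  | _, _, .first (Pi := Pi) P, M, _ =>
      {a | (⟨P, a⟩ : Σ P : Fin Pi.k, Fin (Pi.ar P) → M) ∈ Pi.limit M}
  | _, _, .later (Pi := Pi) P, M, _ =>
      letI := Pi.expansion M
      P.value M

end StratProgram

/-- An S-DATALOG^r formula `(Σ, P) t̄` over `L` with free variables among `x₀, …, xₙ₋₁`. -/
structure StratFormula (L : FirstOrder.Language.{u, v}) (n : ℕ) : Type (max (u + 1) (v + 1)) where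
  prog : StratProgram L
  sym : prog.Sym
  args : Fin sym.ar → Fin n

def StratFormula.Realize {L : FirstOrder.Language.{u, v}} {n : ℕ} (φ : StratFormula L n)
    (M : Type w) [L.Structure M] (a : Fin n → M) : Prop :=
  (fun i => a (φ.args i)) ∈ φ.sym.value M

/-! ### Least fixed-point logic -/

/-- Expressions of FO(LFP) before the positivity condition is imposed. `Δ` lists the arities of
the relation variables that may occur free, and the free first-order variables are among
`x₀, …, xₙ₋₁`. The connectives are `¬, ∨, ∃`; the others are abbreviations. -/
inductive LFPExpr (L : FirstOrder.Language.{u, v}) : List ℕ → ℕ → Type (max u v)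
  /-- `t = s` -/
  | eq {Δ : List ℕ} {n : ℕ} (t s : L.Term (Fin n)) : LFPExpr L Δ n
  /-- `R t₁ … tₘ` for a relation symbol `R` -/
  | rel {Δ : List ℕ} {n m : ℕ} (R : L.Relations m) (ts : Fin m → L.Term (Fin n)) : LFPExpr L Δ n
  /-- `X t₁ … tₘ` for a relation variable `X` -/
  | var {Δ : List ℕ} {n : ℕ} (X : Fin Δ.length) (ts : Fin (Δ.get X) → L.Term (Fin n)) :
      LFPExpr L Δ n
  | neg {Δ : List ℕ} {n : ℕ} (φ : LFPExpr L Δ n) : LFPExpr L Δ n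
  | or {Δ : List ℕ} {n : ℕ} (φ ψ : LFPExpr L Δ n) : LFPExpr L Δ n
  /-- `∃ xₙ, φ` -/
  | ex {Δ : List ℕ} {n : ℕ} (φ : LFPExpr L Δ (n + 1)) : LFPExpr L Δ n
  /-- `[LFP_{z̄, Z} φ] t̄`, where `Z` is the first relation variable of `φ` and
  `z̄ = xₙ, …, xₙ₊ₘ₋₁`; the variables `x₀, …, xₙ₋₁` are parameters. -/
  | lfp {Δ : List ℕ} {n m : ℕ} (φ : LFPExpr L (m :: Δ) (n + m)) (ts : Fin m → L.Term (Fin n)) :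
      LFPExpr L Δ n

namespace LFPExpr

variable {L : FirstOrder.Language.{u, v}}

/-- `φ.Polarity true X`: every free occurrence of `X` in `φ` is positive (in the scope of an even
number of negations). `φ.Polarity false X`: every free occurrence of `X` in `φ` is negative. -/
def Polarity : {Δ : List ℕ} → {n : ℕ} → LFPExpr L Δ n → Bool → Fin Δ.length → Prop
  | _, _, eq _ _, _, _ => True
  | _, _, rel _ _, _, _ => True
  | _, _, var Y _, b, X => Y = X → b = true
  | _, _, neg φ, b, X => φ.Polarity (!b) X
  | _, _, or φ ψ, b, X => φ.Polarity b X ∧ ψ.Polarity b X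
  | _, _, ex φ, b, X => φ.Polarity b X
  | _, _, lfp φ _, b, X => φ.Polarity b X.succ

/-- Every `LFP` operator is applied to a formula that is positive in the bound relation
variable. -/
def WellFormed : {Δ : List ℕ} → {n : ℕ} → LFPExpr L Δ n → Prop
  | _, _, eq _ _ => True
  | _, _, rel _ _ => True
  | _, _, var _ _ => True
  | _, _, neg φ => φ.WellFormed
  | _, _, or φ ψ => φ.WellFormed ∧ ψ.WellFormed
  | _, _, ex φ => φ.WellFormed
  | Δ, _, lfp (m := m) φ _ => φ.Polarity true (0 : Fin (m :: Δ).length) ∧ φ.WellFormed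

/-- Values in `M` for relation variables of arities `Δ`. -/
abbrev Env (Δ : List ℕ) (M : Type w) : Type w := (X : Fin Δ.length) → Set (Fin (Δ.get X) → M)

/-- Add a value for a new first relation variable. -/
def Env.cons {Δ : List ℕ} {M : Type w} {m : ℕ} (S : Set (Fin m → M)) (ρ : Env Δ M) :
    Env (m :: Δ) M :=
  Fin.cons (α := fun X : Fin (Δ.length + 1) => Set (Fin ((m :: Δ).get X) → M)) S ρ

/-- Satisfaction. In the last clause the intersection of all the sets `S` with `F S ⊆ S`, where
`F S = {b | φ(a, b, S)}`, is the least fixed point of `F`, as `F` is monotone by positivity. -/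
def Realize {M : Type w} [L.Structure M] :
    {Δ : List ℕ} → {n : ℕ} → LFPExpr L Δ n → Env Δ M → (Fin n → M) → Prop
  | _, _, eq t s, _, a => t.realize a = s.realize a
  | _, _, rel R ts, _, a => FirstOrder.Language.Structure.RelMap R (fun i => (ts i).realize a)
  | _, _, var X ts, ρ, a => (fun i => (ts i).realize a) ∈ ρ X
  | _, _, neg φ, ρ, a => ¬ φ.Realize ρ a
  | _, _, or φ ψ, ρ, a => φ.Realize ρ a ∨ ψ.Realize ρ a
  | _, _, ex φ, ρ, a => ∃ b : M, φ.Realize ρ (Fin.snoc a b)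
  | _, _, lfp (m := m) φ ts, ρ, a => (fun i => (ts i).realize a) ∈
      ⋂₀ {S : Set (Fin m → M) | {b | φ.Realize (Env.cons S ρ) (Fin.append a b)} ⊆ S}

end LFPExpr

/-- An FO(LFP) formula over `L`, without free relation variables, and with free first-order
variables among `x₀, …, xₙ₋₁`. -/
structure LFPFormula (L : FirstOrder.Language.{u, v}) (n : ℕ) : Type (max u v) where
  expr : LFPExpr L [] n
  wellFormed : expr.WellFormed

def LFPFormula.Realize {L : FirstOrder.Language.{u, v}} {n : ℕ} (φ : LFPFormula L n)
    (M : Type w) [L.Structure M] (a : Fin n → M) : Prop :=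
  φ.expr.Realize (fun X => X.elim0) a

/-! ### Comparison of logics -/

/-- The formulas in `F` and those in `G` (over `L`, with free variables among `x₀, …, xₙ₋₁`, and
with the given satisfaction relations) define the same `n`-ary queries on finite structures. -/
def SameExpressivePower (L : FirstOrder.Language.{u, v}) (n : ℕ) {F G : Type*}
    (satF : F → (M : Type w) → [L.Structure M] → (Fin n → M) → Prop)
    (satG : G → (M : Type w) → [L.Structure M] → (Fin n → M) → Prop) : Prop :=
  (∀ φ : F, ∃ ψ : G, ∀ (M : Type w) [Finite M] [Nonempty M] [L.Structure M] (a : Fin n → M),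
    satF φ M a ↔ satG ψ M a) ∧
  (∀ ψ : G, ∃ φ : F, ∀ (M : Type w) [Finite M] [Nonempty M] [L.Structure M] (a : Fin n → M),
    satF φ M a ↔ satG ψ M a)

end DatalogLFP

open FirstOrder Language

namespace DatalogLFP

/-! ### Programs over finite structures -/

section Limit

variable {L : FirstOrder.Language.{u, v}}

/-! A DATALOG^r formula is a stratified one with a single stratum, so two translations remain:
S-DATALOG^r into FO(LFP), and FO(LFP) into DATALOG^r.

FO(LFP) into DATALOG^r (`LFPExpr.translatable`): rules cannot negate intentional symbols, so the
induction on expressions produces symbols for the expression and for its negation together.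
Universal literals handle negated existential quantifiers, and a relation variable is supplied along
with its complement. The hard case is the complement of a least fixed point. On a finite structure
the stages of the monotone operator stabilise, and a tuple `b` entering at stage `j + 1` serves as a
name for that stage. Membership and non-membership in the named stage are derived by recursion: the
program for the operator's formula, fed with both relations, yields both relations for stage `j +
2`, and `c` names that stage if it lies in it and not in stage `j + 1`. A universal literal
recognises a named stage that is final; a tuple outside it is outside the fixed point. If stage `1`
is empty, no name exists and a separate rule applies. The two halves of correctness are
`lfp_complete` and `lfp_sound`. The programs are first written with untyped symbols and then
converted by `exists_datalogFormula_of_rawRules`.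

S-DATALOG^r into FO(LFP): one application of the rules is expressible positively in the intentional
symbols (`LFPInterpretation.step`). The simultaneous fixed point is turned into nested ones by
Bekić's principle (`Program.mem_relLimit_iff_mem_lfp`). Strata are eliminated by induction
(`LFPInterpretation.expansion`): the symbols of earlier strata become formulas without free relation
variables, which may therefore be negated. -/

theorem Literal.Holds.mono {k : ℕ} {ar : Fin k → ℕ} {M : Type w} [L.Structure M]
    {X Y : Interp ar M} (h : X ⊆ Y) {s : ℕ → M} {l : Literal L ar} (hl : l.Holds X s) :
    l.Holds Y s := by
  cases l with
  | eq | neq | rel | nrel => exact hl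
  | int P ts => exact h hl
  | allInt P ts => exact fun b hb => h (hl b hb)

namespace Program

variable (Pi : Program L) (M : Type w) [L.Structure M]

theorem step_mono : Monotone (Pi.step M) := by
  rintro X Y h f ⟨r, hr, s, hs, rfl⟩
  exact ⟨r, hr, s, fun l hl => (hs l hl).mono h, rfl⟩

theorem stage_mono : Monotone (Pi.stage M) := by
  refine monotone_nat_of_le_succ fun n => ?_
  induction n with
  | zero => exact Set.empty_subset _
  | succ n ih => exact Pi.step_mono M ih

theorem limit_subset_of_step_subset {X : Interp Pi.ar M} (h : Pi.step M X ⊆ X) :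
    Pi.limit M ⊆ X := by
  refine Set.iUnion_subset fun n => ?_
  induction n with
  | zero => exact Set.empty_subset _
  | succ n ih => exact (Pi.step_mono M ih).trans h

/-- An increasing chain of sets of facts over a finite domain is eventually constant. With
`limit_subset_of_step_subset` this makes the limit the least closed interpretation, the only
description of it used later. -/
theorem step_limit_subset [Finite M] : Pi.step M (Pi.limit M) ⊆ Pi.limit M := by
  obtain ⟨n, hn⟩ := WellFoundedGT.monotone_chain_condition
    (⟨Pi.stage M, Pi.stage_mono M⟩ : ℕ →o Interp Pi.ar M)
  have : Pi.limit M ⊆ Pi.stage M n := by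
    refine Set.iUnion_subset fun j => ?_
    rcases le_total n j with h | h
    · exact (hn j h).ge
    · exact Pi.stage_mono M h
  exact (Pi.step_mono M this).trans (Set.subset_iUnion (Pi.stage M) (n + 1))

end Program

end Limit

/-! ### Untyped programs -/

/-- Literals over untyped intentional symbols `K` and variables `V`. Argument lists may have any
length. `all P ts m` stands for `∀ y₁ … yₘ, P ts y₁ … yₘ`. -/
inductive RawLiteral (L : FirstOrder.Language.{u, v}) (K V : Type) : Type (max u v)
  | eq (t s : L.Term V)
  | neq (t s : L.Term V)
  | rel {n : ℕ} (R : L.Relations n) (ts : Fin n → L.Term V)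
  | nrel {n : ℕ} (R : L.Relations n) (ts : Fin n → L.Term V)
  | int (P : K) (ts : List (L.Term V))
  | all (P : K) (ts : List (L.Term V)) (m : ℕ)

/-- Rules over untyped intentional symbols, each with its own type of variables. -/
structure RawRule (L : FirstOrder.Language.{u, v}) (K : Type) : Type (max u v 1) where
  V : Type
  countable : Countable V
  head : K
  headArgs : List (L.Term V)
  body : List (RawLiteral L K V)

section Raw

variable {L : FirstOrder.Language.{u, v}} {K K' V : Type} {M : Type w}

/-- The values of a list of terms. -/
def vals [L.Structure M] (s : V → M) (ts : List (L.Term V)) : List M :=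
  ts.map fun t => t.realize s

@[simp]
theorem vals_append [L.Structure M] (s : V → M) (ts ts' : List (L.Term V)) :
    vals s (ts ++ ts') = vals s ts ++ vals s ts' := List.map_append

@[simp]
theorem vals_length [L.Structure M] (s : V → M) (ts : List (L.Term V)) :
    (vals s ts).length = ts.length := List.length_map _

@[simp]
theorem vals_ofFn [L.Structure M] (s : V → M) {n : ℕ} (ts : Fin n → L.Term V) :
    vals s (List.ofFn ts) = List.ofFn fun i => (ts i).realize s := by
  simp [vals, List.map_ofFn, Function.comp_def]

/-- Truth of a literal. -/
def RawLiteral.Holds [L.Structure M] (Y : K → List M → Prop) (s : V → M) :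
    RawLiteral L K V → Prop
  | .eq t t' => t.realize s = t'.realize s
  | .neq t t' => t.realize s ≠ t'.realize s
  | .rel R ts => Structure.RelMap R (fun i => (ts i).realize s)
  | .nrel R ts => ¬ Structure.RelMap R (fun i => (ts i).realize s)
  | .int P ts => Y P (vals s ts)
  | .all P ts m => ∀ b : Fin m → M, Y P (vals s ts ++ List.ofFn b)

/-- The interpretation `Y` is closed under the rule `r`. -/
def RawRule.Closed [L.Structure M] (r : RawRule L K) (Y : K → List M → Prop) : Prop :=
  ∀ s : r.V → M, (∀ l ∈ r.body, l.Holds Y s) → Y r.head (vals s r.headArgs)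

/-- Renaming of the intentional symbols. -/
def RawLiteral.map (f : K → K') : RawLiteral L K V → RawLiteral L K' V
  | .eq t s => .eq t s
  | .neq t s => .neq t s
  | .rel R ts => .rel R ts
  | .nrel R ts => .nrel R ts
  | .int P ts => .int (f P) ts
  | .all P ts m => .all (f P) ts m

/-- Renaming of the intentional symbols. -/
def RawRule.map (f : K → K') (r : RawRule L K) : RawRule L K' where
  V := r.V
  countable := r.countable
  head := f r.head
  headArgs := r.headArgs
  body := r.body.map (RawLiteral.map f)

theorem RawLiteral.holds_map [L.Structure M] (f : K → K') (Y : K' → List M → Prop) (s : V → M)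
    (l : RawLiteral L K V) : (l.map f).Holds Y s ↔ l.Holds (Y ∘ f) s := by
  cases l <;> rfl

theorem RawRule.closed_map [L.Structure M] (f : K → K') (Y : K' → List M → Prop)
    (r : RawRule L K) : (r.map f).Closed Y ↔ r.Closed (Y ∘ f) := by
  refine forall_congr' fun s => imp_congr ?_ Iff.rfl
  exact List.forall_mem_map.trans (forall₂_congr fun l _ => RawLiteral.holds_map f Y s l)

/-! ### From untyped programs to programs -/

/-- The number of arguments of the intentional symbol in a literal. -/
def RawLiteral.len : RawLiteral L K V → ℕ
  | .int _ ts => ts.length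
  | .all _ ts m => ts.length + m
  | _ => 0

/-- A bound for the numbers of arguments of the intentional symbols in a rule. -/
def RawRule.len (r : RawRule L K) : ℕ := r.headArgs.length + (r.body.map RawLiteral.len).sum

theorem RawRule.len_le_of_mem {r : RawRule L K} {l : RawLiteral L K r.V} (h : l ∈ r.body) :
    l.len ≤ r.len :=
  (List.single_le_sum (by simp) _ (List.mem_map_of_mem h)).trans (Nat.le_add_left _ _)

end Raw

section Typing

variable {L : FirstOrder.Language.{u, v}} {K V : Type} {M : Type w} {k N : ℕ}
  (e : K × Fin (N + 1) ≃ Fin k)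

/-- The arity of the typed symbol with the given index. -/
def typedAr (P : Fin k) : ℕ := (e.symm P).2

theorem typedAr_apply (P : K) {n : ℕ} (h : n < N + 1) : typedAr e (e (P, ⟨n, h⟩)) = n := by
  simp [typedAr]

/-- The typed literal that corresponds to an untyped literal. -/
def RawLiteral.typed (f : V → ℕ) : (l : RawLiteral L K V) → l.len < N + 1 → Literal L (typedAr e)
  | .eq t s, _ => .eq (t.relabel f) (s.relabel f)
  | .neq t s, _ => .neq (t.relabel f) (s.relabel f)
  | .rel R ts, _ => .rel R fun i => (ts i).relabel f
  | .nrel R ts, _ => .nrel R fun i => (ts i).relabel f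
  | .int P ts, h => .int (e (P, ⟨ts.length, h⟩)) fun i =>
      (ts.get (i.cast (typedAr_apply e P h))).relabel f
  | .all P ts m, h => .allInt (e (P, ⟨ts.length + m, h⟩)) fun i =>
      if hi : i.1 < ts.length then some ((ts.get ⟨i.1, hi⟩).relabel f) else none

/-- The typed rule that corresponds to an untyped rule. -/
noncomputable def RawRule.typed (r : RawRule L K) (h : r.len < N + 1) : Rule L (typedAr e) :=
  haveI := r.countable
  let f := (exists_injective_nat r.V).choose
  { head := e (r.head, ⟨r.headArgs.length, (Nat.le_add_right _ _).trans_lt h⟩)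
    headArgs := fun i => (r.headArgs.get (i.cast (typedAr_apply e _ _))).relabel f
    body := r.body.pmap (fun l hl => l.typed e f hl)
      fun _ hl => (RawRule.len_le_of_mem hl).trans_lt h }

/-- The untyped interpretation given by an interpretation of the typed symbols. -/
def untype (X : Interp (typedAr e) M) (P : K) (l : List M) : Prop :=
  ∃ h : l.length < N + 1, (⟨e (P, ⟨l.length, h⟩), fun i => l.get (i.cast (typedAr_apply e P h))⟩ :
    Σ P : Fin k, Fin (typedAr e P) → M) ∈ X

/-- The interpretation of the typed symbols given by an untyped interpretation. -/
def retype (Y : K → List M → Prop) : Interp (typedAr e) M :=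
  {x | Y (e.symm x.1).1 (List.ofFn x.2)}

theorem mem_retype (Y : K → List M → Prop) (x : Σ P : Fin k, Fin (typedAr e P) → M) :
    x ∈ retype e Y ↔ Y (e.symm x.1).1 (List.ofFn x.2) := Iff.rfl

/-- A typed symbol is a pair of an untyped symbol and a length, and the length can be read off the
argument list. This replaces reasoning about dependent pairs by equalities of lists. -/
theorem typedFact_ext {x y : Σ P : Fin k, Fin (typedAr e P) → M} (h : (e.symm x.1).1 = (e.symm y.1).1)
    (h' : List.ofFn x.2 = List.ofFn y.2) : x = y := by
  obtain ⟨P, a⟩ := x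
  obtain ⟨Q, b⟩ := y
  have hl : typedAr e P = typedAr e Q := by simpa using congrArg List.length h'
  obtain rfl : P = Q := e.symm.injective (Prod.ext h (Fin.ext hl))
  exact congrArg _ (List.ofFn_injective h')

theorem mem_iff_untype (X : Interp (typedAr e) M) (x : Σ P : Fin k, Fin (typedAr e P) → M) :
    x ∈ X ↔ untype e X (e.symm x.1).1 (List.ofFn x.2) := by
  have hlt : (List.ofFn x.2).length < N + 1 := by
    rw [List.length_ofFn]; exact (e.symm x.1).2.2
  have : x = ⟨e ((e.symm x.1).1, ⟨(List.ofFn x.2).length, hlt⟩),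
      fun i => (List.ofFn x.2).get (i.cast (typedAr_apply e _ hlt))⟩ := by
    apply typedFact_ext
    · simp
    · refine List.ext_get (by simp [typedAr]) ?_
      intro i h1 h2
      simp
  constructor
  · exact fun h => ⟨hlt, this ▸ h⟩
  · rintro ⟨h1, h2⟩
    rw [this]
    exact h2

/-- Only this composite is the identity in general: `untype e (retype e Y)` forgets the lists longer
than `N`. -/
theorem retype_untype (X : Interp (typedAr e) M) : retype e (untype e X) = X := by
  ext x
  rw [mem_iff_untype e X x]
  rfl

theorem ofFn_get_cast {α β : Type*} (l : List α) (g : α → β) {n : ℕ} (h : n = l.length) :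
    List.ofFn (fun i : Fin n => g (l.get (i.cast h))) = l.map g := by
  subst h
  refine List.ext_get (by simp) ?_
  intro i h1 h2
  simp

theorem RawLiteral.holds_typed [L.Structure M] (Y : K → List M → Prop) (f : V → ℕ) (s : ℕ → M)
    (l : RawLiteral L K V) (h : l.len < N + 1) :
    (l.typed e f h).Holds (retype e Y) s ↔ l.Holds Y (s ∘ f) := by
  cases l with
  | eq | neq | rel | nrel => simp [typed, Literal.Holds, Holds]
  | int P ts =>
    simp only [typed, Literal.Holds, Holds, mem_retype, Term.realize_relabel]
    have := ofFn_get_cast ts (fun t => t.realize (s ∘ f)) (typedAr_apply e P h)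
    rw [Equiv.symm_apply_apply]
    exact iff_of_eq (congrArg (Y P) this)
  | all P ts m =>
    simp only [typed, Literal.Holds, Holds, mem_retype, Equiv.symm_apply_apply]
    have hn : typedAr e (e (P, ⟨ts.length + m, h⟩)) = ts.length + m := typedAr_apply e P h
    -- The arity equals `ts.length + m` only propositionally; generalising it allows substitution,
    -- after which the arguments split as an append.
    revert hn
    generalize typedAr e (e (P, ⟨ts.length + m, h⟩)) = n
    rintro rfl
    constructor
    · intro H b
      have := H (Fin.append (fun i => (ts.get i).realize (s ∘ f)) b) ?_
      · rw [List.ofFn_fin_append] at this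
        convert this using 2
        exact (ofFn_get_cast ts (fun t => t.realize (s ∘ f)) rfl).symm
      · intro i t hi
        split_ifs at hi with hlt
        obtain rfl := Option.some.inj hi
        obtain ⟨i, rfl⟩ : ∃ j : Fin ts.length, i = Fin.castAdd m j := ⟨⟨i, hlt⟩, rfl⟩
        rw [Fin.append_left, Term.realize_relabel]
        rfl
    · intro H b hb
      convert H (fun i => b (Fin.natAdd _ i)) using 1
      rw [← Fin.append_castAdd_natAdd (f := b), List.ofFn_fin_append]
      congr 1
      · refine List.ext_get (by simp) ?_
        intro i h1 h2
        have hi : i < ts.length := by simpa using h1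
        simpa [vals] using hb (Fin.castAdd m ⟨i, hi⟩) ((ts.get ⟨i, hi⟩).relabel f) (by simp [hi])
      · simp

/-- The variables of the rule embed into `ℕ`, and every valuation of them is the restriction of one
of all natural numbers, so both forms of the rule have the same instances. -/
theorem RawRule.closed_iff_typed [L.Structure M] [Nonempty M] (Y : K → List M → Prop)
    (r : RawRule L K) (h : r.len < N + 1) :
    r.Closed Y ↔ ∀ s : ℕ → M, (∀ l ∈ (r.typed e h).body, l.Holds (retype e Y) s) →
      (⟨(r.typed e h).head, fun i => ((r.typed e h).headArgs i).realize s⟩ :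
        Σ P : Fin k, Fin (typedAr e P) → M) ∈ retype e Y := by
  have := r.countable
  have hf := (exists_injective_nat r.V).choose_spec
  have key : ∀ s : ℕ → M, ((∀ l ∈ (r.typed e h).body, l.Holds (retype e Y) s) →
      (⟨(r.typed e h).head, fun i => ((r.typed e h).headArgs i).realize s⟩ :
        Σ P : Fin k, Fin (typedAr e P) → M) ∈ retype e Y) ↔
      ((∀ l ∈ r.body, l.Holds Y (s ∘ (exists_injective_nat r.V).choose)) →
        Y r.head (vals (s ∘ (exists_injective_nat r.V).choose) r.headArgs)) := by
    intro s
    refine imp_congr ?_ ?_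
    · simp only [typed, List.mem_pmap]
      constructor
      · intro H l hl
        exact (RawLiteral.holds_typed e Y _ s l _).1 (H _ ⟨l, hl, rfl⟩)
      · rintro H _ ⟨l, hl, rfl⟩
        exact (RawLiteral.holds_typed e Y _ s l _).2 (H l hl)
    · simp only [typed, mem_retype, Term.realize_relabel]
      rw [ofFn_get_cast r.headArgs (fun t => t.realize (s ∘ (exists_injective_nat r.V).choose))]
      simp [vals]
  simp only [key]
  constructor
  · exact fun H s => H _
  · intro H s
    -- Natural numbers that are not variables of the rule get an arbitrary value, which exists
    -- because the domain is non-empty.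
    have := H (Function.extend (exists_injective_nat r.V).choose s fun _ => Classical.arbitrary M)
    rwa [Function.extend_comp hf] at this

end Typing

/-! ### Definability of least closed interpretations in DATALOG^r -/

/-- The rule `P x̄ ← P x̄`. -/
def Rule.trivial {L : FirstOrder.Language.{u, v}} {k : ℕ} (ar : Fin k → ℕ) (P : Fin k) :
    Rule L ar where
  head := P
  headArgs i := Term.var i
  body := [.int P fun i => Term.var i]

/-- The least interpretation closed under a finite set of untyped rules is definable in
DATALOG^r. -/
theorem exists_datalogFormula_of_rawRules {L : FirstOrder.Language.{u, v}} {K : Type} [Finite K]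
    (R : List (RawRule L K)) (o : K) (n : ℕ) :
    ∃ φ : DatalogFormula L n, ∀ (M : Type w) [Finite M] [Nonempty M] [L.Structure M]
      (a : Fin n → M), φ.Realize M a ↔
        ∀ Y : K → List M → Prop, (∀ r ∈ R, r.Closed Y) → Y o (List.ofFn a) := by
  -- Large enough for the arguments of every rule and for the `n` arguments of the output symbol.
  set N := n + (R.map RawRule.len).sum with hN
  have hR : ∀ r ∈ R, r.len < N + 1 := fun r hr => Nat.lt_succ_of_le <|
    (List.single_le_sum (by simp) _ (List.mem_map_of_mem hr)).trans (Nat.le_add_left _ _)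
  have ho : n < N + 1 := by omega
  obtain ⟨k, ⟨e⟩⟩ := Finite.exists_equiv_fin (K × Fin (N + 1))
  let Pi : Program L :=
    { k := k
      ar := typedAr e
      -- The trivial rules derive nothing new; they make every typed symbol occur in a head.
      rules := R.pmap (fun r hr => r.typed e hr) hR ++ List.ofFn (Rule.trivial (typedAr e))
      head_surjective := fun P => ⟨Rule.trivial _ P, by simp, rfl⟩ }
  refine ⟨⟨Pi, e (o, ⟨n, ho⟩), Fin.cast (typedAr_apply e o ho)⟩, ?_⟩
  intro M _ _ _ a
  have step_iff : ∀ Y : K → List M → Prop,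
      Pi.step M (retype e Y) ⊆ retype e Y ↔ ∀ r ∈ R, r.Closed Y := by
    intro Y
    constructor
    · intro H r hr
      rw [RawRule.closed_iff_typed e Y r (hR r hr)]
      exact fun s hs => H ⟨_, List.mem_append_left _ (List.mem_pmap.2 ⟨r, hr, rfl⟩), s, hs, rfl⟩
    · rintro H _ ⟨r, hr, s, hs, rfl⟩
      rcases List.mem_append.1 hr with hr | hr
      · obtain ⟨r', hr', rfl⟩ := List.mem_pmap.1 hr
        exact (RawRule.closed_iff_typed e Y r' (hR r' hr')).1 (H r' hr') s hs
      · obtain ⟨P, rfl⟩ := (List.mem_ofFn' _ _).1 hr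
        exact hs _ List.mem_cons_self
  have hfact : ∀ X : Interp (typedAr e) M,
      (⟨e (o, ⟨n, ho⟩), fun i => a (Fin.cast (typedAr_apply e o ho) i)⟩ :
        Σ P : Fin k, Fin (typedAr e P) → M) ∈ X ↔ untype e X o (List.ofFn a) := by
    intro X
    rw [mem_iff_untype]
    have : List.ofFn (fun i => a (Fin.cast (typedAr_apply e o ho) i)) = List.ofFn a :=
      (List.ofFn_congr (typedAr_apply e o ho) _)
    simp only [this, Equiv.symm_apply_apply]
  have hret : ∀ Y : K → List M → Prop, untype e (retype e Y) o (List.ofFn a) ↔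
      Y o (List.ofFn a) := by
    intro Y
    rw [← hfact]
    have : List.ofFn (fun i => a (Fin.cast (typedAr_apply e o ho) i)) = List.ofFn a :=
      (List.ofFn_congr (typedAr_apply e o ho) _)
    simp [mem_retype, this]
  refine (hfact _).trans ⟨fun h Y hY => ?_, fun h => ?_⟩
  · have hle := Pi.limit_subset_of_step_subset M ((step_iff Y).2 hY)
    exact (hret Y).1 ((hfact _).1 (hle ((hfact _).2 h)))
  -- The hypothesis is applied to the untyped form of the limit itself, which is closed.
  · refine h _ ((step_iff _).1 ?_)
    rw [retype_untype]
    exact Pi.step_limit_subset M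

/-! ### Stages of monotone operators on finite sets -/

section Stages

variable {α : Type w} (F : Set α → Set α)

/-- The stages of an operator. -/
def opStage : ℕ → Set α
  | 0 => ∅
  | j + 1 => F (opStage j)

/-- The element `b` enters at stage `j + 1`. -/
def Enters (b : α) (j : ℕ) : Prop := b ∈ opStage F (j + 1) ∧ b ∉ opStage F j

variable {F}

theorem opStage_mono (hF : Monotone F) : Monotone (opStage F) := by
  refine monotone_nat_of_le_succ fun n => ?_
  induction n with
  | zero => exact Set.empty_subset _
  | succ n ih => exact hF ih

/-- Hence a tuple that enters names exactly one stage. -/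
theorem Enters.unique (hF : Monotone F) {b : α} {i j : ℕ} (hi : Enters F b i)
    (hj : Enters F b j) : i = j := by
  by_contra h
  rcases Nat.lt_or_gt_of_ne h with h | h
  · exact hj.2 (opStage_mono hF h hi.1)
  · exact hi.2 (opStage_mono hF h hj.1)

theorem exists_enters_le {b : α} {j : ℕ} (h : b ∈ opStage F j) : ∃ i < j, Enters F b i := by
  induction j with
  | zero => exact h.elim
  | succ j ih =>
    by_cases hj : b ∈ opStage F j
    · obtain ⟨i, hi, h'⟩ := ih hj
      exact ⟨i, hi.trans (Nat.lt_succ_self j), h'⟩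
    · exact ⟨j, Nat.lt_succ_self j, h, hj⟩

theorem opStage_subset_sInter (hF : Monotone F) (j : ℕ) :
    opStage F j ⊆ ⋂₀ {S | F S ⊆ S} := by
  refine Set.subset_sInter fun S hS => ?_
  induction j with
  | zero => exact Set.empty_subset _
  | succ j ih => exact (hF ih).trans hS

/-- The least such `j` is taken: by minimality, the final stage is either the empty stage `0` or has
a name `b` that enters just before it. -/
theorem exists_opStage_fixed [Finite α] (hF : Monotone F) :
    ∃ j, opStage F (j + 1) ⊆ opStage F j ∧ (∀ i, i + 1 = j → ∃ b, Enters F b i) := by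
  classical
  obtain ⟨n, hn⟩ := WellFoundedGT.monotone_chain_condition
    (⟨opStage F, opStage_mono hF⟩ : ℕ →o Set α)
  have hex : ∃ j, opStage F (j + 1) ⊆ opStage F j := ⟨n, (hn (n + 1) (Nat.le_succ n)).ge⟩
  refine ⟨Nat.find hex, Nat.find_spec hex, fun i hi => ?_⟩
  have := Nat.find_min hex (m := i) (by omega)
  obtain ⟨b, hb, hb'⟩ := Set.not_subset.1 this
  exact ⟨b, hb, hb'⟩

theorem mem_sInter_iff_exists_enters [Finite α] (hF : Monotone F) {b : α} :
    b ∈ ⋂₀ {S | F S ⊆ S} ↔ ∃ j, Enters F b j := by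
  constructor
  · intro h
    obtain ⟨j, hj, -⟩ := exists_opStage_fixed hF
    obtain ⟨i, -, hi⟩ := exists_enters_le (h _ hj)
    exact ⟨i, hi⟩
  · rintro ⟨j, hj, -⟩
    exact opStage_subset_sInter hF _ hj

theorem sInter_subset_opStage {j : ℕ} (h : opStage F (j + 1) ⊆ opStage F j) :
    ⋂₀ {S | F S ⊆ S} ⊆ opStage F j :=
  Set.sInter_subset_of_mem h

end Stages

/-! ### Positivity and monotonicity -/

namespace LFPExpr

variable {L : FirstOrder.Language.{u, v}}

/-- The hypothesis lets each variable grow, shrink or stay fixed on its own. Negation exchanges the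
first two cases, and a variable bound by a nested `lfp` falls under the third. -/
theorem Realize.mono {M : Type w} [L.Structure M] {Δ : List ℕ} {n : ℕ} {φ : LFPExpr L Δ n}
    {ρ ρ' : Env Δ M} (h : ∀ X, (φ.Polarity true X ∧ ρ X ⊆ ρ' X) ∨
      (φ.Polarity false X ∧ ρ' X ⊆ ρ X) ∨ ρ X = ρ' X) {a : Fin n → M} (H : φ.Realize ρ a) :
    φ.Realize ρ' a := by
  induction φ with
  | eq | rel => exact H
  | var X ts =>
    rcases h X with h | h | h
    · exact h.2 H
    · exact absurd (h.1 rfl) (by simp)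
    · exact (congrArg (_ ∈ ·) h).mp H
  | neg φ ih =>
    refine fun H' => H (ih (fun X => ?_) H')
    rcases h X with h | h | h
    · exact Or.inr (Or.inl h)
    · exact Or.inl h
    · exact Or.inr (Or.inr h.symm)
  | or φ ψ ih₁ ih₂ =>
    refine H.imp (ih₁ fun X => ?_) (ih₂ fun X => ?_)
    · exact (h X).imp (fun h => ⟨h.1.1, h.2⟩) (Or.imp (fun h => ⟨h.1.1, h.2⟩) id)
    · exact (h X).imp (fun h => ⟨h.1.2, h.2⟩) (Or.imp (fun h => ⟨h.1.2, h.2⟩) id)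
  | ex φ ih =>
    obtain ⟨b, hb⟩ := H
    exact ⟨b, ih h hb⟩
  | lfp φ ts ih =>
    intro S hS
    refine H S fun b hb => hS (ih (fun X => ?_) hb)
    refine Fin.cases ?_ (fun X => ?_) X
    · exact Or.inr (Or.inr rfl)
    · exact h X

/-- The operator whose least fixed point is taken in `lfp φ`. -/
def op {M : Type w} [L.Structure M] {Δ : List ℕ} {n m : ℕ} (φ : LFPExpr L (m :: Δ) (n + m))
    (ρ : Env Δ M) (a : Fin n → M) (S : Set (Fin m → M)) : Set (Fin m → M) :=
  {b | φ.Realize (Env.cons S ρ) (Fin.append a b)}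

theorem op_mono {M : Type w} [L.Structure M] {Δ : List ℕ} {n m : ℕ}
    {φ : LFPExpr L (m :: Δ) (n + m)} (h : φ.Polarity true (0 : Fin (m :: Δ).length))
    (ρ : Env Δ M) (a : Fin n → M) : Monotone (φ.op ρ a) := by
  refine fun S T hST b hb => Realize.mono (fun X => ?_) hb
  refine Fin.cases ?_ (fun X => ?_) X
  · exact Or.inl ⟨h, hST⟩
  · exact Or.inr (Or.inr rfl)

end LFPExpr

/-! ### From FO(LFP) to untyped programs -/

section Blocks

variable {L : FirstOrder.Language.{u, v}} {V : Type} {M : Type w}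

/-- A block of variables, as a list of terms. -/
def blk {n : ℕ} (f : Fin n → V) : List (L.Term V) := List.ofFn fun i => Term.var (f i)

@[simp]
theorem vals_blk [L.Structure M] (s : V → M) {n : ℕ} (f : Fin n → V) :
    vals s (blk (L := L) f) = List.ofFn (s ∘ f) := by
  simp [blk, Function.comp_def]

@[simp]
theorem append_ofFn_inj {n : ℕ} {l l' : List M} {a a' : Fin n → M} :
    l ++ List.ofFn a = l' ++ List.ofFn a' ↔ l = l' ∧ a = a' := by
  constructor
  · intro h
    obtain ⟨h1, h2⟩ := List.append_inj' h (by simp)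
    exact ⟨h1, List.ofFn_injective h2⟩
  · rintro ⟨rfl, rfl⟩
    rfl

theorem ofFn_snoc {n : ℕ} (a : Fin n → M) (b : M) :
    List.ofFn (Fin.snoc a b : Fin (n + 1) → M) = List.ofFn a ++ [b] := by
  rw [List.ofFn_succ']
  simp [List.concat_eq_append]

/-- The lists that satisfy `Q` whenever they are split into a prefix and a tuple. -/
def Forced {n : ℕ} (Q : List M → (Fin n → M) → Prop) (x : List M) : Prop :=
  ∀ l a, x = l ++ List.ofFn a → Q l a

-- The length of the tuple is fixed, so a list can be split in at most one way.
@[simp]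
theorem forced_append {n : ℕ} {Q : List M → (Fin n → M) → Prop} {l : List M} {a : Fin n → M} :
    Forced Q (l ++ List.ofFn a) ↔ Q l a := by
  constructor
  · exact fun h => h l a rfl
  · rintro h l' a' h'
    obtain ⟨rfl, rfl⟩ := append_ofFn_inj.1 h'
    exact h

end Blocks

/-- The symbols `pos` and `neg` of the untyped program `R` define `e` and its negation, uniformly
in `q` additional arguments. The inputs `(X, true)` and `(X, false)` stand for the relation
variable `X` and for its complement. -/
structure Translates {L : FirstOrder.Language.{u, v}} {Δ : List ℕ} {n : ℕ} (e : LFPExpr L Δ n)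
    (q : ℕ) {K : Type} (R : List (RawRule L (K ⊕ Fin Δ.length × Bool))) (pos neg : K) : Prop where
  -- Stated for every closed interpretation, hence in particular for the least one. The prefix `p`
  -- matters in nested fixed points, where the value of a relation variable depends on a tuple
  -- naming a stage.
  complete : ∀ (M : Type w) [Finite M] [Nonempty M] [L.Structure M]
    (Y : K ⊕ Fin Δ.length × Bool → List M → Prop), (∀ r ∈ R, r.Closed Y) →
    ∀ (p : Fin q → M) (ρ : LFPExpr.Env Δ M),
      (∀ X d, d ∈ ρ X → Y (Sum.inr (X, true)) (List.ofFn p ++ List.ofFn d)) →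
      (∀ X d, d ∉ ρ X → Y (Sum.inr (X, false)) (List.ofFn p ++ List.ofFn d)) →
      ∀ a, (e.Realize ρ a → Y (Sum.inl pos) (List.ofFn p ++ List.ofFn a)) ∧
        (¬ e.Realize ρ a → Y (Sum.inl neg) (List.ofFn p ++ List.ofFn a))
  -- One closed interpretation without false facts bounds the least one. It must serve all prefixes
  -- at once, so each prefix `l` carries its own set `C l` of admissible environments; if `C l` is
  -- empty, nothing is claimed there.
  sound : ∀ (M : Type w) [Finite M] [Nonempty M] [L.Structure M]
    (C : List M → Set (LFPExpr.Env Δ M)) (Yin : Fin Δ.length × Bool → List M → Prop),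
      (∀ X l d, Yin (X, true) (l ++ List.ofFn d) → ∀ ρ ∈ C l, d ∈ ρ X) →
      (∀ X l d, Yin (X, false) (l ++ List.ofFn d) → ∀ ρ ∈ C l, d ∉ ρ X) →
      ∃ Y : K → List M → Prop, (∀ r ∈ R, r.Closed (Sum.elim Y Yin)) ∧
        (∀ l a, Y pos (l ++ List.ofFn a) → ∀ ρ ∈ C l, e.Realize ρ a) ∧
        (∀ l a, Y neg (l ++ List.ofFn a) → ∀ ρ ∈ C l, ¬ e.Realize ρ a)

/-- Every `q` admits an untyped program for `e`. -/
def Translatable {L : FirstOrder.Language.{u, v}} {Δ : List ℕ} {n : ℕ} (e : LFPExpr L Δ n) : Prop :=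
  ∀ q, ∃ (K : Type) (_ : Finite K) (R : List (RawRule L (K ⊕ Fin Δ.length × Bool))) (pos neg : K),
    Translates.{u, v, w} e q R pos neg

section Translate

variable {L : FirstOrder.Language.{u, v}} {Δ : List ℕ} {n : ℕ}

/-- A rule whose variables are `q` parameters and `n` further variables, with these as the
arguments of the head. -/
abbrev blockRule {K : Type} (q n : ℕ) (P : K) (body : List (RawLiteral L K (Fin q ⊕ Fin n))) :
    RawRule L K where
  V := Fin q ⊕ Fin n
  countable := inferInstance
  head := P
  headArgs := blk Sum.inl ++ blk Sum.inr
  body := body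

theorem blockRule_closed {K : Type} {q n : ℕ} {P : K} {body : List (RawLiteral L K (Fin q ⊕ Fin n))}
    {M : Type w} [L.Structure M] {Y : K → List M → Prop} :
    (blockRule q n P body).Closed Y ↔ ∀ (p : Fin q → M) (a : Fin n → M),
      (∀ l ∈ body, l.Holds Y (Sum.elim p a)) → Y P (List.ofFn p ++ List.ofFn a) := by
  constructor
  · intro h p a hl
    simpa [Function.comp_def] using h (Sum.elim p a) hl
  · intro h s hl
    have := h (s ∘ Sum.inl) (s ∘ Sum.inr) (by rwa [Sum.elim_comp_inl_inr])
    simpa using this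

/-- A literal and its negation, as long as the positive relation variables stand for the
complements of the negative ones, translate to a pair of rules. -/
theorem translatable_of_literals {e : LFPExpr L Δ n}
    (pl nl : ∀ q : ℕ, RawLiteral L (Bool ⊕ Fin Δ.length × Bool) (Fin q ⊕ Fin n))
    (hc : ∀ (q : ℕ) (M : Type w) [L.Structure M] (Y : Bool ⊕ Fin Δ.length × Bool → List M → Prop)
      (p : Fin q → M) (ρ : LFPExpr.Env Δ M),
      (∀ X d, d ∈ ρ X → Y (Sum.inr (X, true)) (List.ofFn p ++ List.ofFn d)) →
      (∀ X d, d ∉ ρ X → Y (Sum.inr (X, false)) (List.ofFn p ++ List.ofFn d)) →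
      ∀ a, (e.Realize ρ a → (pl q).Holds Y (Sum.elim p a)) ∧
        (¬ e.Realize ρ a → (nl q).Holds Y (Sum.elim p a)))
    (hs : ∀ (q : ℕ) (M : Type w) [L.Structure M] (Y : Bool ⊕ Fin Δ.length × Bool → List M → Prop)
      (p : Fin q → M) (ρ : LFPExpr.Env Δ M),
      (∀ X d, Y (Sum.inr (X, true)) (List.ofFn p ++ List.ofFn d) → d ∈ ρ X) →
      (∀ X d, Y (Sum.inr (X, false)) (List.ofFn p ++ List.ofFn d) → d ∉ ρ X) →
      ∀ a, ((pl q).Holds Y (Sum.elim p a) → e.Realize ρ a) ∧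
        ((nl q).Holds Y (Sum.elim p a) → ¬ e.Realize ρ a)) :
    Translatable.{u, v, w} e := by
  intro q
  refine ⟨Bool, inferInstance, [blockRule q n (Sum.inl true) [pl q],
    blockRule q n (Sum.inl false) [nl q] ], true, false, ?_, ?_⟩
  · intro M _ _ _ Y hY p ρ h1 h2 a
    simp only [List.forall_mem_cons, blockRule_closed] at hY
    obtain ⟨hp, hn⟩ := hc q M Y p ρ h1 h2 a
    exact ⟨fun h => hY.1 p a ⟨hp h, by simp⟩, fun h => hY.2.1 p a ⟨hn h, by simp⟩⟩
  · intro M _ _ _ C Yin h1 h2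
    refine ⟨fun b => Forced fun l a => ∀ ρ ∈ C l,
      if b then e.Realize ρ a else ¬ e.Realize ρ a, ?_, ?_, ?_⟩
    · simp only [List.forall_mem_cons, blockRule_closed, Sum.elim_inl, forced_append]
      refine ⟨fun p a h ρ hρ => ?_, fun p a h ρ hρ => ?_, by simp⟩
      · simpa using (hs q M _ p ρ (fun X d h => h1 X _ d h ρ hρ)
          (fun X d h => h2 X _ d h ρ hρ) a).1 h.1
      · simpa using (hs q M _ p ρ (fun X d h => h1 X _ d h ρ hρ)
          (fun X d h => h2 X _ d h ρ hρ) a).2 h.1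
    · intro l a h
      simpa using h
    · intro l a h
      simpa using h

theorem translatable_eq (t s : L.Term (Fin n)) :
    Translatable.{u, v, w} (LFPExpr.eq (Δ := Δ) t s) := by
  refine translatable_of_literals (fun q => .eq (t.relabel Sum.inr) (s.relabel Sum.inr))
    (fun q => .neq (t.relabel Sum.inr) (s.relabel Sum.inr)) ?_ ?_ <;>
  · intros
    simp [RawLiteral.Holds, LFPExpr.Realize]

theorem translatable_rel {m : ℕ} (R : L.Relations m) (ts : Fin m → L.Term (Fin n)) :
    Translatable.{u, v, w} (LFPExpr.rel (Δ := Δ) R ts) := by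
  refine translatable_of_literals (fun q => .rel R fun i => (ts i).relabel Sum.inr)
    (fun q => .nrel R fun i => (ts i).relabel Sum.inr) ?_ ?_ <;>
  · intros
    simp [RawLiteral.Holds, LFPExpr.Realize]

theorem translatable_var (X : Fin Δ.length) (ts : Fin (Δ.get X) → L.Term (Fin n)) :
    Translatable.{u, v, w} (LFPExpr.var X ts) := by
  refine translatable_of_literals
    (fun q => .int (Sum.inr (X, true)) (blk Sum.inl ++ List.ofFn fun i => (ts i).relabel Sum.inr))
    (fun q => .int (Sum.inr (X, false)) (blk Sum.inl ++ List.ofFn fun i => (ts i).relabel Sum.inr))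
    ?_ ?_
  · intro q M _ Y p ρ h1 h2 a
    have h1 := h1 X fun i => (ts i).realize a
    have h2 := h2 X fun i => (ts i).realize a
    simpa [RawLiteral.Holds, LFPExpr.Realize, Sum.elim_comp_inl] using And.intro h1 h2
  · intro q M _ Y p ρ h1 h2 a
    have h1 := h1 X fun i => (ts i).realize a
    have h2 := h2 X fun i => (ts i).realize a
    simpa [RawLiteral.Holds, LFPExpr.Realize, Sum.elim_comp_inl] using And.intro h1 h2

/-- The two output symbols are exchanged; no rule is added. -/
theorem Translatable.neg {e : LFPExpr L Δ n} (h : Translatable.{u, v, w} e) :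
    Translatable.{u, v, w} e.neg := by
  intro q
  obtain ⟨K, hK, R, pos, neg, hc, hs⟩ := h q
  refine ⟨K, hK, R, neg, pos, ?_, ?_⟩
  · intro M _ _ _ Y hY p ρ h1 h2 a
    obtain ⟨hp, hn⟩ := hc M Y hY p ρ h1 h2 a
    exact ⟨hn, fun h => hp (not_not.1 h)⟩
  · intro M _ _ _ C Yin h1 h2
    obtain ⟨Y, hY, hp, hn⟩ := hs M C Yin h1 h2
    exact ⟨Y, hY, hn, fun l a h ρ hρ h' => h' (hp l a h ρ hρ)⟩

theorem Translatable.or {e₁ e₂ : LFPExpr L Δ n} (H₁ : Translatable.{u, v, w} e₁)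
    (H₂ : Translatable.{u, v, w} e₂) : Translatable.{u, v, w} (e₁.or e₂) := by
  intro q
  obtain ⟨K₁, hK₁, R₁, pos₁, neg₁, hc₁, hs₁⟩ := H₁ q
  obtain ⟨K₂, hK₂, R₂, pos₂, neg₂, hc₂, hs₂⟩ := H₂ q
  let In := Fin Δ.length × Bool
  let f₁ : K₁ ⊕ In → (Bool ⊕ K₁ ⊕ K₂) ⊕ In := Sum.map (Sum.inr ∘ Sum.inl) id
  let f₂ : K₂ ⊕ In → (Bool ⊕ K₁ ⊕ K₂) ⊕ In := Sum.map (Sum.inr ∘ Sum.inr) id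
  let args : List (L.Term (Fin q ⊕ Fin n)) := blk Sum.inl ++ blk Sum.inr
  refine ⟨Bool ⊕ K₁ ⊕ K₂, inferInstance,
    [blockRule q n (Sum.inl (Sum.inl true)) [.int (f₁ (Sum.inl pos₁)) args],
      blockRule q n (Sum.inl (Sum.inl true)) [.int (f₂ (Sum.inl pos₂)) args],
      blockRule q n (Sum.inl (Sum.inl false))
        [.int (f₁ (Sum.inl neg₁)) args, .int (f₂ (Sum.inl neg₂)) args] ] ++
      (R₁.map (RawRule.map f₁) ++ R₂.map (RawRule.map f₂)),
    Sum.inl true, Sum.inl false, ?_, ?_⟩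
  · intro M _ _ _ Y hY p ρ h1 h2 a
    simp only [List.forall_mem_append, List.forall_mem_cons, List.forall_mem_map,
      RawRule.closed_map, blockRule_closed] at hY
    obtain ⟨⟨r1, r2, r3, -⟩, hR₁, hR₂⟩ := hY
    obtain ⟨p1, n1⟩ := hc₁ M _ hR₁ p ρ h1 h2 a
    obtain ⟨p2, n2⟩ := hc₂ M _ hR₂ p ρ h1 h2 a
    replace r1 := r1 p a
    replace r2 := r2 p a
    replace r3 := r3 p a
    simp only [RawLiteral.Holds, args, vals_append, vals_blk, Sum.elim_comp_inl,
      Sum.elim_comp_inr] at r1 r2 r3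
    constructor
    · rintro (h | h)
      · exact r1 ⟨p1 h, by simp⟩
      · exact r2 ⟨p2 h, by simp⟩
    · intro h
      exact r3 ⟨n1 fun h' => h (Or.inl h'), n2 fun h' => h (Or.inr h'), by simp⟩
  · intro M _ _ _ C Yin h1 h2
    obtain ⟨Y₁, hY₁, hp₁, hn₁⟩ := hs₁ M C Yin h1 h2
    obtain ⟨Y₂, hY₂, hp₂, hn₂⟩ := hs₂ M C Yin h1 h2
    let Y : Bool ⊕ K₁ ⊕ K₂ → List M → Prop := Sum.elim (fun b => Forced fun l a => ∀ ρ ∈ C l,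
      if b then (e₁.or e₂).Realize ρ a else ¬ (e₁.or e₂).Realize ρ a) (Sum.elim Y₁ Y₂)
    have e1 : Sum.elim Y Yin ∘ f₁ = Sum.elim Y₁ Yin := by ext (_ | _) <;> rfl
    have e2 : Sum.elim Y Yin ∘ f₂ = Sum.elim Y₂ Yin := by ext (_ | _) <;> rfl
    refine ⟨Y, ?_, ?_, ?_⟩
    · simp only [List.forall_mem_append, List.forall_mem_cons, List.forall_mem_map,
        RawRule.closed_map, blockRule_closed, e1, e2]
      refine ⟨⟨?_, ?_, ?_, by simp⟩, hY₁, hY₂⟩ <;>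
      · intro p a h
        simp only [RawLiteral.Holds, args, vals_append, vals_blk, Sum.elim_comp_inl,
          Sum.elim_comp_inr] at h
        simp only [Y, Sum.elim_inl, forced_append]
        intro ρ hρ
        first
          | exact Or.inl (hp₁ _ _ h.1 ρ hρ)
          | exact Or.inr (hp₂ _ _ h.1 ρ hρ)
          | exact fun h' => h'.elim (hn₁ _ _ h.1 ρ hρ) (hn₂ _ _ h.2.1 ρ hρ)
    · intro l a h
      simpa [Y] using h
    · intro l a h
      simpa [Y] using h

theorem Translatable.ex {e : LFPExpr L Δ (n + 1)} (H : Translatable.{u, v, w} e) :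
    Translatable.{u, v, w} e.ex := by
  intro q
  obtain ⟨K, hK, R, pos, neg, hc, hs⟩ := H q
  let In := Fin Δ.length × Bool
  let f : K ⊕ In → (Bool ⊕ K) ⊕ In := Sum.map Sum.inr id
  -- The last of the `n + 1` variables is missing from the head, so it is existentially quantified.
  let r₁ : RawRule L ((Bool ⊕ K) ⊕ In) :=
    { V := Fin q ⊕ Fin (n + 1)
      countable := inferInstance
      head := Sum.inl (Sum.inl true)
      headArgs := blk Sum.inl ++ blk fun i => Sum.inr i.castSucc
      body := [.int (f (Sum.inl pos)) (blk Sum.inl ++ blk Sum.inr)] }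
  refine ⟨Bool ⊕ K, inferInstance,
    [r₁, blockRule q n (Sum.inl (Sum.inl false))
        [.all (f (Sum.inl neg)) (blk Sum.inl ++ blk Sum.inr) 1] ] ++ R.map (RawRule.map f),
    Sum.inl true, Sum.inl false, ?_, ?_⟩
  · intro M _ _ _ Y hY p ρ h1 h2 a
    simp only [List.forall_mem_append, List.forall_mem_cons, List.forall_mem_map,
      RawRule.closed_map, blockRule_closed] at hY
    obtain ⟨⟨c1, c2, -⟩, hR⟩ := hY
    have IH := hc M _ hR p ρ h1 h2
    constructor
    · rintro ⟨b, hb⟩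
      have := c1 (Sum.elim p (Fin.snoc a b)) ?_
      · simpa [r₁, Function.comp_def] using this
      · simpa [r₁, RawLiteral.Holds] using (IH _).1 hb
    · intro h
      refine c2 p a ?_
      simp only [RawLiteral.Holds, vals_append, vals_blk, Sum.elim_comp_inl, Sum.elim_comp_inr]
      refine ⟨fun b => ?_, by simp⟩
      have := (IH (Fin.snoc a (b 0))).2 fun h' => h ⟨_, h'⟩
      rw [ofFn_snoc] at this
      simpa using this
  · intro M _ _ _ C Yin h1 h2
    obtain ⟨Y', hY', hp, hn⟩ := hs M C Yin h1 h2
    let Y : Bool ⊕ K → List M → Prop := Sum.elim (fun b => Forced fun l a => ∀ ρ ∈ C l,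
      if b then e.ex.Realize ρ a else ¬ e.ex.Realize ρ a) Y'
    have e1 : Sum.elim Y Yin ∘ f = Sum.elim Y' Yin := by ext (_ | _) <;> rfl
    refine ⟨Y, ?_, ?_, ?_⟩
    · simp only [List.forall_mem_append, List.forall_mem_cons, List.forall_mem_map,
        RawRule.closed_map, blockRule_closed, e1]
      refine ⟨⟨?_, ?_, by simp⟩, hY'⟩
      · intro s h
        simp only [r₁, List.forall_mem_cons, RawLiteral.Holds, vals_append, vals_blk] at h
        simp only [r₁, vals_append, vals_blk, Y, Sum.elim_inl, forced_append]
        intro ρ hρ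
        refine ⟨s (Sum.inr (Fin.last n)), ?_⟩
        convert hp _ _ h.1 ρ hρ using 1
        ext i
        refine Fin.lastCases ?_ (fun i => ?_) i <;> simp
      · intro p a h
        simp only [RawLiteral.Holds, vals_append, vals_blk, Sum.elim_comp_inl,
          Sum.elim_comp_inr] at h
        simp only [Y, Sum.elim_inl, forced_append]
        rintro ρ hρ ⟨b, hb⟩
        refine hn (List.ofFn p) _ ?_ ρ hρ hb
        rw [ofFn_snoc]
        change Sum.elim Y Yin (f (Sum.inl neg)) _
        simpa using h.1 fun _ => b
    · intro l a h
      simpa [Y] using h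
    · intro l a h
      simpa [Y] using h

end Translate

/-! ### The translation of least fixed points -/

/-- The symbols of the program for `lfp φ`. Two copies of the symbols of programs for `φ` are used:
`start` with the empty set as value of the fixed-point variable, and `next` with the values
`{d | mem p a b d}`, where `p` are the given parameters, `a` those of the operator, and `b` is a
tuple that represents the stage at which it enters. -/
inductive LfpSym (K₀ K₁ : Type) (r : ℕ) : Type
  | start (k : K₀)
  | next (k : K₁)
  | mem
  | notMem
  | empty
  | full
  | closing
  | pos
  | neg
  | input (X : Fin r) (b : Bool)

instance {K₀ K₁ : Type} {r : ℕ} [Finite K₀] [Finite K₁] : Finite (LfpSym K₀ K₁ r) := by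
  let f : K₀ ⊕ K₁ ⊕ (Fin r × Bool) ⊕ Fin 7 → LfpSym K₀ K₁ r :=
    Sum.elim .start (Sum.elim .next (Sum.elim (fun x => .input x.1 x.2)
      ![.mem, .notMem, .empty, .full, .closing, .pos, .neg]))
  refine Finite.of_surjective f fun x => ?_
  cases x with
  | start k => exact ⟨Sum.inl k, rfl⟩
  | next k => exact ⟨Sum.inr (Sum.inl k), rfl⟩
  | input X b => exact ⟨Sum.inr (Sum.inr (Sum.inl (X, b))), rfl⟩
  | mem => exact ⟨Sum.inr (Sum.inr (Sum.inr 0)), rfl⟩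
  | notMem => exact ⟨Sum.inr (Sum.inr (Sum.inr 1)), rfl⟩
  | empty => exact ⟨Sum.inr (Sum.inr (Sum.inr 2)), rfl⟩
  | full => exact ⟨Sum.inr (Sum.inr (Sum.inr 3)), rfl⟩
  | closing => exact ⟨Sum.inr (Sum.inr (Sum.inr 4)), rfl⟩
  | pos => exact ⟨Sum.inr (Sum.inr (Sum.inr 5)), rfl⟩
  | neg => exact ⟨Sum.inr (Sum.inr (Sum.inr 6)), rfl⟩

section Lfp

variable {L : FirstOrder.Language.{u, v}} {Δ : List ℕ} {q n m : ℕ} {K₀ K₁ : Type}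

/-- The symbols of the first copy in the program for `lfp φ`. -/
def startMap : K₀ ⊕ Fin (m :: Δ).length × Bool →
    LfpSym K₀ K₁ Δ.length ⊕ Fin Δ.length × Bool
  | .inl k => .inl (.start k)
  | .inr (X, b) => Fin.cases (motive := fun _ => LfpSym K₀ K₁ Δ.length ⊕ Fin Δ.length × Bool)
      (.inl (if b then .empty else .full)) (fun X => .inr (X, b)) X

/-- The symbols of the second copy in the program for `lfp φ`. -/
def nextMap : K₁ ⊕ Fin (m :: Δ).length × Bool →
    LfpSym K₀ K₁ Δ.length ⊕ Fin Δ.length × Bool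
  | .inl k => .inl (.next k)
  | .inr (X, b) => Fin.cases (motive := fun _ => LfpSym K₀ K₁ Δ.length ⊕ Fin Δ.length × Bool)
      (.inl (if b then .mem else .notMem)) (fun X => .inl (.input X b)) X

/-- The variables of the main rules of the program for `lfp φ`: five blocks. -/
abbrev LfpVar (q n m : ℕ) : Type := Fin q ⊕ Fin n ⊕ Fin m ⊕ Fin m ⊕ Fin m

/-- A valuation, from the values of the five blocks. -/
abbrev lfpVal {M : Type w} (p : Fin q → M) (a : Fin n → M) (b c d : Fin m → M) :
    LfpVar q n m → M :=
  Sum.elim p (Sum.elim a (Sum.elim b (Sum.elim c d)))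

/-- A rule in these variables. -/
abbrev lfpRule {K : Type} (P : K) (args : List (L.Term (LfpVar q n m)))
    (body : List (RawLiteral L K (LfpVar q n m))) : RawRule L K where
  V := LfpVar q n m
  countable := inferInstance
  head := P
  headArgs := args
  body := body

theorem lfpRule_closed {K : Type} {P : K} {args : List (L.Term (LfpVar q n m))}
    {body : List (RawLiteral L K (LfpVar q n m))} {M : Type w} [L.Structure M]
    {Y : K → List M → Prop} :
    (lfpRule P args body).Closed Y ↔ ∀ (p : Fin q → M) (a : Fin n → M) (b c d : Fin m → M),
      (∀ l ∈ body, l.Holds Y (lfpVal p a b c d)) → Y P (vals (lfpVal p a b c d) args) := by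
  constructor
  · exact fun h p a b c d => h (lfpVal p a b c d)
  · intro h s
    have e : lfpVal (fun i => s (.inl i)) (fun i => s (.inr (.inl i)))
        (fun i => s (.inr (.inr (.inl i)))) (fun i => s (.inr (.inr (.inr (.inl i)))))
        (fun i => s (.inr (.inr (.inr (.inr i))))) = s := by
      ext (_ | _ | _ | _ | _) <;> rfl
    exact e ▸ h _ _ _ _ _

/-- The block of the parameters of the program. -/
def vP : List (L.Term (LfpVar q n m)) := blk Sum.inl
/-- The block of the parameters of the operator. -/
def vA : List (L.Term (LfpVar q n m)) := blk fun i => .inr (.inl i)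
/-- The first block of variables for elements of the fixed point. -/
def vB : List (L.Term (LfpVar q n m)) := blk fun i => .inr (.inr (.inl i))
/-- The second block of variables for elements of the fixed point. -/
def vC : List (L.Term (LfpVar q n m)) := blk fun i => .inr (.inr (.inr (.inl i)))
/-- The third block of variables for elements of the fixed point. -/
def vD : List (L.Term (LfpVar q n m)) := blk fun i => .inr (.inr (.inr (.inr i)))

section Vals

variable {M : Type w} [L.Structure M] (p : Fin q → M) (a : Fin n → M) (b c d : Fin m → M)

@[simp] theorem vals_vP : vals (lfpVal p a b c d) (vP (L := L)) = List.ofFn p := by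
  simp [vP, Function.comp_def]
@[simp] theorem vals_vA : vals (lfpVal p a b c d) (vA (L := L)) = List.ofFn a := by
  simp [vA, Function.comp_def]
@[simp] theorem vals_vB : vals (lfpVal p a b c d) (vB (L := L)) = List.ofFn b := by
  simp [vB, Function.comp_def]
@[simp] theorem vals_vC : vals (lfpVal p a b c d) (vC (L := L)) = List.ofFn c := by
  simp [vC, Function.comp_def]
@[simp] theorem vals_vD : vals (lfpVal p a b c d) (vD (L := L)) = List.ofFn d := by
  simp [vD, Function.comp_def]

/-- Terms in the parameters of the operator. -/
def vT (ts : Fin m → L.Term (Fin n)) : List (L.Term (LfpVar q n m)) :=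
  List.ofFn fun i => (ts i).relabel fun j => .inr (.inl j)

@[simp] theorem vals_vT (ts : Fin m → L.Term (Fin n)) :
    vals (lfpVal p a b c d) (vT ts) = List.ofFn fun i => (ts i).realize a := by
  simp [vT, Function.comp_def]

end Vals

/-- The main rules of the program for `lfp φ`. -/
def lfpRules (q : ℕ) (ts : Fin m → L.Term (Fin n)) (pos₀ neg₀ : K₀) (pos₁ neg₁ : K₁) :
    List (RawRule L (LfpSym K₀ K₁ Δ.length ⊕ Fin Δ.length × Bool)) :=
  [blockRule q m (.inl .full) [],
    -- Stage `1` comes from the first copy; every `c` in it is a name for it.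
    lfpRule (q := q) (n := n) (m := m) (.inl .mem) (vP ++ (vA ++ (vC ++ vD)))
      [.int (.inl (.start pos₀)) (vP ++ (vA ++ vC)), .int (.inl (.start pos₀)) (vP ++ (vA ++ vD))],
    lfpRule (q := q) (n := n) (m := m) (.inl .notMem) (vP ++ (vA ++ (vC ++ vD)))
      [.int (.inl (.start pos₀)) (vP ++ (vA ++ vC)), .int (.inl (.start neg₀)) (vP ++ (vA ++ vD))],
    -- If `b` names a stage, then `c` names the next one when it lies in the next stage but not in
    -- that of `b`.
    lfpRule (q := q) (n := n) (m := m) (.inl .mem) (vP ++ (vA ++ (vC ++ vD)))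
      [.int (.inl (.next pos₁)) (vP ++ (vA ++ (vB ++ (vA ++ vC)))),
        .int (.inl .notMem) (vP ++ (vA ++ (vB ++ vC))),
        .int (.inl (.next pos₁)) (vP ++ (vA ++ (vB ++ (vA ++ vD))))],
    lfpRule (q := q) (n := n) (m := m) (.inl .notMem) (vP ++ (vA ++ (vC ++ vD)))
      [.int (.inl (.next pos₁)) (vP ++ (vA ++ (vB ++ (vA ++ vC)))),
        .int (.inl .notMem) (vP ++ (vA ++ (vB ++ vC))),
        .int (.inl (.next neg₁)) (vP ++ (vA ++ (vB ++ (vA ++ vD))))],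
    -- `closing` at `b`, `d` means that `d` is not new in the stage after that of `b`: it is already
    -- in the stage of `b`, or not in the next one.
    lfpRule (q := q) (n := n) (m := m) (.inl .closing) (vP ++ (vA ++ (vB ++ vD)))
      [.int (.inl .mem) (vP ++ (vA ++ (vB ++ vD)))],
    lfpRule (q := q) (n := n) (m := m) (.inl .closing) (vP ++ (vA ++ (vB ++ vD)))
      [.int (.inl (.next neg₁)) (vP ++ (vA ++ (vB ++ (vA ++ vD))))],
    -- A tuple that belongs to the fixed point enters at some stage and lies in the stage it names.
    lfpRule (q := q) (n := n) (m := m) (.inl .pos) (vP ++ vA)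
      [.int (.inl .mem) (vP ++ (vA ++ (vT ts ++ vT ts)))],
    -- The tuple is outside the stage of `b`, and no `d` is new after it, so that stage is the fixed
    -- point.
    lfpRule (q := q) (n := n) (m := m) (.inl .neg) (vP ++ vA)
      [.int (.inl .notMem) (vP ++ (vA ++ (vB ++ vT ts))),
        .all (.inl .closing) (vP ++ (vA ++ vB)) m],
    -- If stage `1` is empty, so is the fixed point, and no tuple names a stage.
    lfpRule (q := q) (n := n) (m := m) (.inl .neg) (vP ++ vA)
      [.all (.inl (.start neg₀)) (vP ++ vA) m] ]

/-- The rules that pass the other relation variables to the second copy. -/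
noncomputable def inputRules (q n m : ℕ) :
    List (RawRule L (LfpSym K₀ K₁ Δ.length ⊕ Fin Δ.length × Bool)) :=
  (Finset.univ : Finset (Fin Δ.length × Bool)).toList.map fun x =>
    blockRule (q + n + m) (Δ.get x.1) (.inl (.input x.1 x.2))
      [.int (.inr x) (blk (fun i : Fin q => .inl (Fin.castAdd m (Fin.castAdd n i))) ++ blk .inr)]

section Semantics

variable {M : Type w} [L.Structure M]
  {Y : LfpSym K₀ K₁ Δ.length ⊕ Fin Δ.length × Bool → List M → Prop}

local notation "ℓ" => List.ofFn

/-- The rules in conventional notation. An anonymous tuple is a block of variables that does not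
occur in the rule. -/
theorem lfpRules_closed {ts : Fin m → L.Term (Fin n)} {pos₀ neg₀ : K₀} {pos₁ neg₁ : K₁} :
    (∀ r ∈ lfpRules (Δ := Δ) q ts pos₀ neg₀ pos₁ neg₁, r.Closed Y) ↔
    (∀ (p : Fin q → M) (d : Fin m → M), Y (.inl .full) (ℓ p ++ ℓ d)) ∧
    (∀ (p : Fin q → M) (a : Fin n → M) (_ c d : Fin m → M),
      Y (.inl (.start pos₀)) (ℓ p ++ (ℓ a ++ ℓ c)) →
      Y (.inl (.start pos₀)) (ℓ p ++ (ℓ a ++ ℓ d)) →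
      Y (.inl .mem) (ℓ p ++ (ℓ a ++ (ℓ c ++ ℓ d)))) ∧
    (∀ (p : Fin q → M) (a : Fin n → M) (_ c d : Fin m → M),
      Y (.inl (.start pos₀)) (ℓ p ++ (ℓ a ++ ℓ c)) →
      Y (.inl (.start neg₀)) (ℓ p ++ (ℓ a ++ ℓ d)) →
      Y (.inl .notMem) (ℓ p ++ (ℓ a ++ (ℓ c ++ ℓ d)))) ∧
    (∀ (p : Fin q → M) (a : Fin n → M) (b c d : Fin m → M),
      Y (.inl (.next pos₁)) (ℓ p ++ (ℓ a ++ (ℓ b ++ (ℓ a ++ ℓ c)))) →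
      Y (.inl .notMem) (ℓ p ++ (ℓ a ++ (ℓ b ++ ℓ c))) →
      Y (.inl (.next pos₁)) (ℓ p ++ (ℓ a ++ (ℓ b ++ (ℓ a ++ ℓ d)))) →
      Y (.inl .mem) (ℓ p ++ (ℓ a ++ (ℓ c ++ ℓ d)))) ∧
    (∀ (p : Fin q → M) (a : Fin n → M) (b c d : Fin m → M),
      Y (.inl (.next pos₁)) (ℓ p ++ (ℓ a ++ (ℓ b ++ (ℓ a ++ ℓ c)))) →
      Y (.inl .notMem) (ℓ p ++ (ℓ a ++ (ℓ b ++ ℓ c))) →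
      Y (.inl (.next neg₁)) (ℓ p ++ (ℓ a ++ (ℓ b ++ (ℓ a ++ ℓ d)))) →
      Y (.inl .notMem) (ℓ p ++ (ℓ a ++ (ℓ c ++ ℓ d)))) ∧
    (∀ (p : Fin q → M) (a : Fin n → M) (b _ d : Fin m → M),
      Y (.inl .mem) (ℓ p ++ (ℓ a ++ (ℓ b ++ ℓ d))) →
      Y (.inl .closing) (ℓ p ++ (ℓ a ++ (ℓ b ++ ℓ d)))) ∧
    (∀ (p : Fin q → M) (a : Fin n → M) (b _ d : Fin m → M),
      Y (.inl (.next neg₁)) (ℓ p ++ (ℓ a ++ (ℓ b ++ (ℓ a ++ ℓ d)))) →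
      Y (.inl .closing) (ℓ p ++ (ℓ a ++ (ℓ b ++ ℓ d)))) ∧
    (∀ (p : Fin q → M) (a : Fin n → M) (_ _ _ : Fin m → M),
      Y (.inl .mem) (ℓ p ++ (ℓ a ++ ((ℓ fun i => (ts i).realize a) ++
        ℓ fun i => (ts i).realize a))) →
      Y (.inl .pos) (ℓ p ++ ℓ a)) ∧
    (∀ (p : Fin q → M) (a : Fin n → M) (b _ _ : Fin m → M),
      Y (.inl .notMem) (ℓ p ++ (ℓ a ++ (ℓ b ++ ℓ fun i => (ts i).realize a))) →
      (∀ d : Fin m → M, Y (.inl .closing) (ℓ p ++ (ℓ a ++ (ℓ b ++ ℓ d)))) →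
      Y (.inl .neg) (ℓ p ++ ℓ a)) ∧
    (∀ (p : Fin q → M) (a : Fin n → M) (_ _ _ : Fin m → M),
      (∀ d : Fin m → M, Y (.inl (.start neg₀)) (ℓ p ++ (ℓ a ++ ℓ d))) →
      Y (.inl .neg) (ℓ p ++ ℓ a)) := by
  simp only [lfpRules, List.forall_mem_cons, lfpRule_closed, blockRule_closed, RawLiteral.Holds,
    vals_append, vals_vP, vals_vA, vals_vB, vals_vC, vals_vD, vals_vT, List.append_assoc,
    and_imp, List.not_mem_nil, false_imp_iff, imp_true_iff, true_imp_iff, and_true]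

theorem inputRules_closed :
    (∀ r ∈ inputRules (L := L) (K₀ := K₀) (K₁ := K₁) (Δ := Δ) q n m, r.Closed Y) ↔
    ∀ X s (p : Fin q → M) (a : Fin n → M) (b : Fin m → M) (d : Fin (Δ.get X) → M),
      Y (.inr (X, s)) (ℓ p ++ ℓ d) → Y (.inl (.input X s)) (ℓ p ++ (ℓ a ++ (ℓ b ++ ℓ d))) := by
  simp only [inputRules, List.forall_mem_map, Finset.mem_toList, Finset.mem_univ, true_imp_iff,
    blockRule_closed, List.forall_mem_cons, RawLiteral.Holds, vals_append, vals_blk,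
    List.not_mem_nil, false_imp_iff, imp_true_iff, and_true, Sum.elim_comp_inr, Prod.forall]
  refine forall₂_congr fun X s => ?_
  constructor
  · intro h p a b d hd
    have := h (Fin.append (Fin.append p a) b) d
    simp only [List.ofFn_fin_append, List.append_assoc] at this
    refine this ?_
    convert hd using 3
    ext i
    simp
  · intro h p d hd
    obtain ⟨p, b, rfl⟩ : ∃ p' b, p = Fin.append p' b := ⟨_, _, Fin.append_castAdd_natAdd.symm⟩
    obtain ⟨p, a, rfl⟩ : ∃ p' a, p = Fin.append p' a := ⟨_, _, Fin.append_castAdd_natAdd.symm⟩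
    simp only [List.ofFn_fin_append, List.append_assoc]
    refine h p a b d ?_
    convert hd using 3
    ext i
    simp

end Semantics

/-- The lists that satisfy `Q` whenever they are split into a prefix and three tuples. -/
def Forced₃ {M : Type w} {n m k : ℕ}
    (Q : List M → (Fin n → M) → (Fin m → M) → (Fin k → M) → Prop) (x : List M) : Prop :=
  ∀ l a b d, x = l ++ (List.ofFn a ++ (List.ofFn b ++ List.ofFn d)) → Q l a b d

theorem append₃_inj {M : Type w} {n m k : ℕ} {l l' : List M} {a a' : Fin n → M} {b b' : Fin m → M}
    {d d' : Fin k → M} :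
    l ++ (List.ofFn a ++ (List.ofFn b ++ List.ofFn d)) =
      l' ++ (List.ofFn a' ++ (List.ofFn b' ++ List.ofFn d')) ↔
    l = l' ∧ a = a' ∧ b = b' ∧ d = d' := by
  simp only [← List.append_assoc, append_ofFn_inj, and_assoc]

@[simp]
theorem forced₃_append {M : Type w} {n m k : ℕ}
    {Q : List M → (Fin n → M) → (Fin m → M) → (Fin k → M) → Prop} {l : List M} {a : Fin n → M}
    {b : Fin m → M} {d : Fin k → M} :
    Forced₃ Q (l ++ (List.ofFn a ++ (List.ofFn b ++ List.ofFn d))) ↔ Q l a b d := by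
  constructor
  · exact fun h => h l a b d rfl
  · rintro h l' a' b' d' h'
    obtain ⟨rfl, rfl, rfl, rfl⟩ := append₃_inj.1 h'
    exact h

end Lfp

/-! ### Correctness of the program for a least fixed point -/

section LfpTranslation

variable {L : FirstOrder.Language.{u, v}} {Δ : List ℕ} {q n m : ℕ}

local notation "ℓ" => List.ofFn

theorem LFPExpr.realize_lfp {M : Type w} [L.Structure M] {φ : LFPExpr L (m :: Δ) (n + m)}
    {ts : Fin m → L.Term (Fin n)} {ρ : LFPExpr.Env Δ M} {a : Fin n → M} :
    (LFPExpr.lfp φ ts).Realize ρ a ↔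
      (fun i => (ts i).realize a) ∈ ⋂₀ {S | φ.op ρ a S ⊆ S} := Iff.rfl

variable {K₀ K₁ : Type} {φ : LFPExpr L (m :: Δ) (n + m)} {ts : Fin m → L.Term (Fin n)}
  {R₀ : List (RawRule L (K₀ ⊕ Fin (m :: Δ).length × Bool))}
  {R₁ : List (RawRule L (K₁ ⊕ Fin (m :: Δ).length × Bool))} {pos₀ neg₀ : K₀} {pos₁ neg₁ : K₁}

/-- Induction on the stage `j` at which `b` enters: correct values for one stage, fed to the second
copy, give correct values for the next. The final stage then decides the negative case. -/
theorem lfp_complete (hφ : φ.Polarity true (0 : Fin (m :: Δ).length))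
    (h₀ : Translates.{u, v, w} φ q R₀ pos₀ neg₀)
    (h₁ : Translates.{u, v, w} φ (q + n + m) R₁ pos₁ neg₁)
    (M : Type w) [Finite M] [Nonempty M] [L.Structure M]
    (Y : LfpSym K₀ K₁ Δ.length ⊕ Fin Δ.length × Bool → List M → Prop)
    (hY : ∀ r ∈ lfpRules q ts pos₀ neg₀ pos₁ neg₁, r.Closed Y)
    (hin : ∀ r ∈ inputRules (L := L) (K₀ := K₀) (K₁ := K₁) (Δ := Δ) q n m, r.Closed Y)
    (hR₀ : ∀ r ∈ R₀, r.Closed (Y ∘ startMap)) (hR₁ : ∀ r ∈ R₁, r.Closed (Y ∘ nextMap))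
    (p : Fin q → M) (ρ : LFPExpr.Env Δ M)
    (hp : ∀ X d, d ∈ ρ X → Y (Sum.inr (X, true)) (ℓ p ++ ℓ d))
    (hn : ∀ X d, d ∉ ρ X → Y (Sum.inr (X, false)) (ℓ p ++ ℓ d)) (a : Fin n → M) :
    ((LFPExpr.lfp φ ts).Realize ρ a → Y (.inl .pos) (ℓ p ++ ℓ a)) ∧
      (¬ (LFPExpr.lfp φ ts).Realize ρ a → Y (.inl .neg) (ℓ p ++ ℓ a)) := by
  obtain ⟨rfull, rmem₀, rnot₀, rmem₁, rnot₁, rcl, rcl', rpos, rneg, rneg'⟩ := lfpRules_closed.1 hY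
  rw [inputRules_closed] at hin
  have hF := LFPExpr.op_mono hφ ρ a
  have start : ∀ c, (c ∈ opStage (φ.op ρ a) 1 → Y (.inl (.start pos₀)) (ℓ p ++ (ℓ a ++ ℓ c))) ∧
      (c ∉ opStage (φ.op ρ a) 1 → Y (.inl (.start neg₀)) (ℓ p ++ (ℓ a ++ ℓ c))) := by
    intro c
    have := h₀.complete M _ hR₀ p (LFPExpr.Env.cons ∅ ρ) ?_ ?_ (Fin.append a c)
    · simp only [List.ofFn_fin_append] at this
      exact this
    · intro X
      refine Fin.cases ?_ (fun X => ?_) X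
      · exact fun d hd => hd.elim
      · exact hp X
    · intro X
      refine Fin.cases ?_ (fun X => ?_) X
      · exact fun d _ => rfull p d
      · exact hn X
  have hnext : ∀ (j : ℕ) (b : Fin m → M), (∀ d, d ∈ opStage (φ.op ρ a) (j + 1) →
        Y (.inl .mem) (ℓ p ++ (ℓ a ++ (ℓ b ++ ℓ d)))) →
      (∀ d, d ∉ opStage (φ.op ρ a) (j + 1) →
        Y (.inl .notMem) (ℓ p ++ (ℓ a ++ (ℓ b ++ ℓ d)))) →
      ∀ c, (c ∈ opStage (φ.op ρ a) (j + 2) →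
        Y (.inl (.next pos₁)) (ℓ p ++ (ℓ a ++ (ℓ b ++ (ℓ a ++ ℓ c))))) ∧
      (c ∉ opStage (φ.op ρ a) (j + 2) →
        Y (.inl (.next neg₁)) (ℓ p ++ (ℓ a ++ (ℓ b ++ (ℓ a ++ ℓ c))))) := by
    intro j b hT hN c
    have := h₁.complete M _ hR₁ (Fin.append (Fin.append p a) b)
      (LFPExpr.Env.cons (opStage (φ.op ρ a) (j + 1)) ρ) ?_ ?_ (Fin.append a c)
    · simp only [List.ofFn_fin_append, List.append_assoc] at this
      exact this
    · intro X
      simp only [List.ofFn_fin_append, List.append_assoc]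
      refine Fin.cases ?_ (fun X => ?_) X
      · exact hT
      · exact fun d hd => hin X true p a b d (hp X d hd)
    · intro X
      simp only [List.ofFn_fin_append, List.append_assoc]
      refine Fin.cases ?_ (fun X => ?_) X
      · exact hN
      · exact fun d hd => hin X false p a b d (hn X d hd)
  have main : ∀ (j : ℕ) (b : Fin m → M), Enters (φ.op ρ a) b j →
      (∀ d, d ∈ opStage (φ.op ρ a) (j + 1) → Y (.inl .mem) (ℓ p ++ (ℓ a ++ (ℓ b ++ ℓ d)))) ∧
      (∀ d, d ∉ opStage (φ.op ρ a) (j + 1) →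
        Y (.inl .notMem) (ℓ p ++ (ℓ a ++ (ℓ b ++ ℓ d)))) := by
    intro j
    induction j with
    | zero =>
      intro b hb
      have := (start b).1 hb.1
      exact ⟨fun d hd => rmem₀ p a b b d this ((start d).1 hd),
        fun d hd => rnot₀ p a b b d this ((start d).2 hd)⟩
    | succ j ih =>
      intro c hc
      -- The preceding stage has a name: had nothing entered there, the operator would already be
      -- stationary and `c` could not enter later.
      obtain ⟨b, hb⟩ : ∃ b, Enters (φ.op ρ a) b j := by
        by_contra hne
        have hsub : opStage (φ.op ρ a) (j + 1) ⊆ opStage (φ.op ρ a) j :=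
          fun b hb => by_contra fun hb' => hne ⟨b, hb, hb'⟩
        exact hc.2 (hF hsub hc.1)
      obtain ⟨hT, hN⟩ := ih b hb
      have hcopy := hnext j b hT hN
      have h1 := (hcopy c).1 hc.1
      have h2 := hN c hc.2
      exact ⟨fun d hd => rmem₁ p a b c d h1 h2 ((hcopy d).1 hd),
        fun d hd => rnot₁ p a b c d h1 h2 ((hcopy d).2 hd)⟩
  constructor
  · intro h
    obtain ⟨j, hj⟩ := (mem_sInter_iff_exists_enters hF).1 (LFPExpr.realize_lfp.1 h)
    -- This tuple only fills the blocks that the rules below do not use.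
    have t := fun i => (ts i).realize a
    exact rpos p a t t t ((main j _ hj).1 _ hj.1)
  · intro h
    have t := fun i => (ts i).realize a
    obtain ⟨j, hj, hb⟩ := exists_opStage_fixed hF
    have hnot : (fun i => (ts i).realize a) ∉ opStage (φ.op ρ a) j :=
      fun h' => h (opStage_subset_sInter hF j h')
    cases j with
    | zero => exact rneg' p a t t t fun d => (start d).2 fun hd => hj hd
    | succ j =>
      obtain ⟨b, hb⟩ := hb j rfl
      obtain ⟨hT, hN⟩ := main j b hb
      refine rneg p a b t t (hN _ hnot) fun d => ?_
      by_cases hd : d ∈ opStage (φ.op ρ a) (j + 1)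
      · exact rcl p a b t d (hT d hd)
      · exact rcl' p a b t d ((hnext j b hT hN d).2 fun h' => hd (hj h'))

/-- The symbols receive their intended meanings, for all admissible environments at once. `mem` and
`notMem` assert that `b` does enter, whereas `closing` is conditional on it: the second copy
guarantees nothing at a `b` that names no stage. -/
theorem lfp_sound (hφ : φ.Polarity true (0 : Fin (m :: Δ).length))
    (h₀ : Translates.{u, v, w} φ q R₀ pos₀ neg₀)
    (h₁ : Translates.{u, v, w} φ (q + n + m) R₁ pos₁ neg₁)
    (M : Type w) [Finite M] [Nonempty M] [L.Structure M]
    (C : List M → Set (LFPExpr.Env Δ M)) (Yin : Fin Δ.length × Bool → List M → Prop)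
    (hp : ∀ X l d, Yin (X, true) (l ++ ℓ d) → ∀ ρ ∈ C l, d ∈ ρ X)
    (hn : ∀ X l d, Yin (X, false) (l ++ ℓ d) → ∀ ρ ∈ C l, d ∉ ρ X) :
    ∃ Y : LfpSym K₀ K₁ Δ.length → List M → Prop,
      (∀ r ∈ lfpRules q ts pos₀ neg₀ pos₁ neg₁, r.Closed (Sum.elim Y Yin)) ∧
      (∀ r ∈ inputRules (L := L) (K₀ := K₀) (K₁ := K₁) (Δ := Δ) q n m,
        r.Closed (Sum.elim Y Yin)) ∧
      (∀ r ∈ R₀, r.Closed (Sum.elim Y Yin ∘ startMap)) ∧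
      (∀ r ∈ R₁, r.Closed (Sum.elim Y Yin ∘ nextMap)) ∧
      (∀ l a, Y .pos (l ++ ℓ a) → ∀ ρ ∈ C l, (LFPExpr.lfp φ ts).Realize ρ a) ∧
      (∀ l a, Y .neg (l ++ ℓ a) → ∀ ρ ∈ C l, ¬ (LFPExpr.lfp φ ts).Realize ρ a) := by
  have hF := fun (ρ : LFPExpr.Env Δ M) a => LFPExpr.op_mono hφ ρ a
  let st : LFPExpr.Env Δ M → (Fin n → M) → ℕ → Set (Fin m → M) :=
    fun ρ a => opStage (φ.op ρ a)
  let Y : (K₀ → List M → Prop) → (K₁ → List M → Prop) →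
      LfpSym K₀ K₁ Δ.length → List M → Prop := fun Y₀ Y₁ x => match x with
    | .start k => Y₀ k
    | .next k => Y₁ k
    | .mem => Forced₃ fun l a b d => ∀ ρ ∈ C l, ∃ j, Enters (φ.op ρ a) b j ∧ d ∈ st ρ a (j + 1)
    | .notMem => Forced₃ fun l a b d => ∀ ρ ∈ C l, ∃ j, Enters (φ.op ρ a) b j ∧ d ∉ st ρ a (j + 1)
    | .empty => fun _ => False
    | .full => fun _ => True
    | .closing => Forced₃ fun l a b d => ∀ ρ ∈ C l, ∀ j, Enters (φ.op ρ a) b j →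
        d ∈ st ρ a (j + 2) → d ∈ st ρ a (j + 1)
    | .pos => Forced fun l a => ∀ ρ ∈ C l, (LFPExpr.lfp φ ts).Realize ρ a
    | .neg => Forced fun l a => ∀ ρ ∈ C l, ¬ (LFPExpr.lfp φ ts).Realize ρ a
    | .input X s => Forced₃ (n := n) (m := m) (k := Δ.get X) fun l _ _ d => Yin (X, s) (l ++ ℓ d)
  let C₀ : List M → Set (LFPExpr.Env (m :: Δ) M) := fun l =>
    {ρ' | ∃ ρ ∈ C l, ρ' = LFPExpr.Env.cons ∅ ρ}
  -- In the second copy the prefix includes `a` and `b`, and the fixed-point variable takes the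
  -- stage named by `b`. If `b` names no stage for any environment in `C l'`, no environment is
  -- admissible.
  let C₁ : List M → Set (LFPExpr.Env (m :: Δ) M) := fun l =>
    {ρ' | ∃ l' a b, l = l' ++ (ℓ a ++ ℓ b) ∧ ∃ ρ ∈ C l', ∃ j, Enters (φ.op ρ a) b j ∧
      ρ' = LFPExpr.Env.cons (st ρ a (j + 1)) ρ}
  -- The inputs of the copies do not depend on the symbols inside the copies, so those are filled
  -- with a dummy here; `e₀` and `e₁` below put in the actual ones.
  obtain ⟨Y₀, hY₀, hp₀, hn₀⟩ := h₀.sound M C₀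
    (fun x => Sum.elim (Y (fun _ _ => False) fun _ _ => False) Yin (startMap (.inr x))) (by
      intro X l d h
      rintro _ ⟨ρ, hρ, rfl⟩
      induction X using Fin.cases with
      | zero => exact h.elim
      | succ X => exact hp X l d h ρ hρ) (by
      intro X l d h
      rintro _ ⟨ρ, hρ, rfl⟩
      induction X using Fin.cases with
      | zero => exact id
      | succ X => exact hn X l d h ρ hρ)
  obtain ⟨Y₁, hY₁, hp₁, hn₁⟩ := h₁.sound M C₁
    (fun x => Sum.elim (Y (fun _ _ => False) fun _ _ => False) Yin (nextMap (.inr x))) (by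
      intro X l d h
      rintro _ ⟨l, a, b, rfl, ρ, hρ, j, hj, rfl⟩
      simp only [List.append_assoc] at h
      induction X using Fin.cases with
      | zero =>
        obtain ⟨i, hi, hd⟩ := forced₃_append.1 h ρ hρ
        obtain rfl := hi.unique (hF ρ a) hj
        exact hd
      | succ X => exact hp X l d (forced₃_append.1 h) ρ hρ) (by
      intro X l d h
      rintro _ ⟨l, a, b, rfl, ρ, hρ, j, hj, rfl⟩
      simp only [List.append_assoc] at h
      induction X using Fin.cases with
      | zero =>
        obtain ⟨i, hi, hd⟩ := forced₃_append.1 h ρ hρ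
        obtain rfl := hi.unique (hF ρ a) hj
        exact hd
      | succ X => exact hn X l d (forced₃_append.1 h) ρ hρ)
  have start_pos : ∀ {l a c}, Y₀ pos₀ (l ++ (ℓ a ++ ℓ c)) → ∀ ρ ∈ C l, c ∈ st ρ a 1 := by
    intro l a c h ρ hρ
    rw [← List.ofFn_fin_append] at h
    exact hp₀ l _ h _ ⟨ρ, hρ, rfl⟩
  have start_neg : ∀ {l a c}, Y₀ neg₀ (l ++ (ℓ a ++ ℓ c)) → ∀ ρ ∈ C l, c ∉ st ρ a 1 := by
    intro l a c h ρ hρ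
    rw [← List.ofFn_fin_append] at h
    exact hn₀ l _ h _ ⟨ρ, hρ, rfl⟩
  have next_pos : ∀ {l a b c}, Y₁ pos₁ (l ++ (ℓ a ++ (ℓ b ++ (ℓ a ++ ℓ c)))) →
      ∀ ρ ∈ C l, ∀ j, Enters (φ.op ρ a) b j → c ∈ st ρ a (j + 2) := by
    intro l a b c h ρ hρ j hj
    rw [← List.ofFn_fin_append, ← List.append_assoc (ℓ a), ← List.append_assoc] at h
    exact hp₁ _ _ h _ ⟨l, a, b, rfl, ρ, hρ, j, hj, rfl⟩
  have next_neg : ∀ {l a b c}, Y₁ neg₁ (l ++ (ℓ a ++ (ℓ b ++ (ℓ a ++ ℓ c)))) →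
      ∀ ρ ∈ C l, ∀ j, Enters (φ.op ρ a) b j → c ∉ st ρ a (j + 2) := by
    intro l a b c h ρ hρ j hj
    rw [← List.ofFn_fin_append, ← List.append_assoc (ℓ a), ← List.append_assoc] at h
    exact hn₁ _ _ h _ ⟨l, a, b, rfl, ρ, hρ, j, hj, rfl⟩
  have e₀ : Sum.elim (Y Y₀ Y₁) Yin ∘ startMap (m := m) = Sum.elim Y₀ (fun x =>
      Sum.elim (Y (fun _ _ => False) fun _ _ => False) Yin (startMap (m := m) (.inr x))) := by
    funext x
    rcases x with k | ⟨X, b⟩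
    · rfl
    · induction X using Fin.cases with
      | zero => cases b <;> rfl
      | succ X => rfl
  have e₁ : Sum.elim (Y Y₀ Y₁) Yin ∘ nextMap (m := m) = Sum.elim Y₁ (fun x =>
      Sum.elim (Y (fun _ _ => False) fun _ _ => False) Yin (nextMap (m := m) (.inr x))) := by
    funext x
    rcases x with k | ⟨X, b⟩
    · rfl
    · induction X using Fin.cases with
      | zero => cases b <;> rfl
      | succ X => rfl
  refine ⟨Y Y₀ Y₁, lfpRules_closed.2 ⟨?_, ?_, ?_, ?_, ?_, ?_, ?_, ?_, ?_, ?_⟩, ?_, ?_, ?_,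
    fun l a => forced_append.1, fun l a => forced_append.1⟩
  · exact fun p d => trivial
  · intro p a _ c d h1 h2
    refine forced₃_append.2 fun ρ hρ => ⟨0, ⟨start_pos h1 ρ hρ, id⟩, start_pos h2 ρ hρ⟩
  · intro p a _ c d h1 h2
    refine forced₃_append.2 fun ρ hρ => ⟨0, ⟨start_pos h1 ρ hρ, id⟩, start_neg h2 ρ hρ⟩
  · intro p a b c d h1 h2 h3
    refine forced₃_append.2 fun ρ hρ => ?_
    obtain ⟨j, hj, hc⟩ := forced₃_append.1 h2 ρ hρ
    -- The literal `notMem` both fixes the stage of `b` and says that `c` is not yet in it, so `c`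
    -- enters one stage later.
    exact ⟨j + 1, ⟨next_pos h1 ρ hρ j hj, hc⟩, next_pos h3 ρ hρ j hj⟩
  · intro p a b c d h1 h2 h3
    refine forced₃_append.2 fun ρ hρ => ?_
    obtain ⟨j, hj, hc⟩ := forced₃_append.1 h2 ρ hρ
    exact ⟨j + 1, ⟨next_pos h1 ρ hρ j hj, hc⟩, next_neg h3 ρ hρ j hj⟩
  · intro p a b _ d h
    refine forced₃_append.2 fun ρ hρ j hj _ => ?_
    obtain ⟨i, hi, hd⟩ := forced₃_append.1 h ρ hρ
    obtain rfl := hi.unique (hF ρ a) hj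
    exact hd
  · intro p a b _ d h
    exact forced₃_append.2 fun ρ hρ j hj hd => absurd hd (next_neg h ρ hρ j hj)
  · intro p a _ _ _ h
    refine forced_append.2 fun ρ hρ => ?_
    obtain ⟨j, hj, -⟩ := forced₃_append.1 h ρ hρ
    exact LFPExpr.realize_lfp.2 ((mem_sInter_iff_exists_enters (hF ρ a)).2 ⟨j, hj⟩)
  · intro p a b _ _ h h'
    refine forced_append.2 fun ρ hρ hlfp => ?_
    obtain ⟨j, hj, hts⟩ := forced₃_append.1 h ρ hρ
    exact hts (sInter_subset_opStage (fun d hd => forced₃_append.1 (h' d) ρ hρ j hj hd)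
      (LFPExpr.realize_lfp.1 hlfp))
  · intro p a _ _ _ h
    refine forced_append.2 fun ρ hρ hlfp => ?_
    exact sInter_subset_opStage (F := φ.op ρ a) (j := 0)
      (fun d hd => absurd hd (start_neg (h d) ρ hρ)) (LFPExpr.realize_lfp.1 hlfp)
  · exact inputRules_closed.2 fun X s p a b d h => forced₃_append.2 h
  · rwa [e₀]
  · rwa [e₁]

theorem Translatable.lfp (hφ : φ.Polarity true (0 : Fin (m :: Δ).length))
    (H : Translatable.{u, v, w} φ) (ts : Fin m → L.Term (Fin n)) :
    Translatable.{u, v, w} (LFPExpr.lfp φ ts) := by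
  intro q
  obtain ⟨K₀, _, R₀, pos₀, neg₀, h₀⟩ := H q
  obtain ⟨K₁, _, R₁, pos₁, neg₁, h₁⟩ := H (q + n + m)
  refine ⟨LfpSym K₀ K₁ Δ.length, inferInstance,
    lfpRules q ts pos₀ neg₀ pos₁ neg₁ ++ (inputRules q n m ++
      (R₀.map (RawRule.map startMap) ++ R₁.map (RawRule.map nextMap))), .pos, .neg, ?_, ?_⟩
  · intro M _ _ _ Y hY p ρ hp hn a
    simp only [List.forall_mem_append, List.forall_mem_map, RawRule.closed_map] at hY
    exact lfp_complete hφ h₀ h₁ M Y hY.1 hY.2.1 hY.2.2.1 hY.2.2.2 p ρ hp hn a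
  · intro M _ _ _ C Yin hp hn
    obtain ⟨Y, h1, h2, h3, h4, h5, h6⟩ := lfp_sound (ts := ts) hφ h₀ h₁ M C Yin hp hn
    refine ⟨Y, ?_, h5, h6⟩
    simp only [List.forall_mem_append, List.forall_mem_map, RawRule.closed_map]
    exact ⟨h1, h2, h3, h4⟩

end LfpTranslation

theorem LFPExpr.translatable {L : FirstOrder.Language.{u, v}} {Δ : List ℕ} {n : ℕ}
    (e : LFPExpr L Δ n) (he : e.WellFormed) : Translatable.{u, v, w} e := by
  induction e with
  | eq t s => exact translatable_eq t s
  | rel R ts => exact translatable_rel R ts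
  | var X ts => exact translatable_var X ts
  | neg φ ih => exact (ih he).neg
  | or φ ψ ih₁ ih₂ => exact (ih₁ he.1).or (ih₂ he.2)
  | ex φ ih => exact (ih he).ex
  | lfp φ ts ih => exact (ih he.2).lfp he.1 ts

/-- On finite structures, every formula of FO(LFP) is equivalent to a DATALOG^r formula. -/
theorem LFPFormula.exists_datalogFormula {L : FirstOrder.Language.{u, v}} {n : ℕ}
    (φ : LFPFormula L n) :
    ∃ ψ : DatalogFormula L n, ∀ (M : Type w) [Finite M] [Nonempty M] [L.Structure M]
      (a : Fin n → M), ψ.Realize M a ↔ φ.Realize M a := by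
  obtain ⟨K, _, R, pos, neg, h⟩ := φ.expr.translatable φ.wellFormed 0
  obtain ⟨ψ, hψ⟩ := exists_datalogFormula_of_rawRules.{u, v, w} R (Sum.inl pos) n
  refine ⟨ψ, fun M _ _ _ a => (hψ M a).trans ⟨fun H => ?_, fun H Y hY => ?_⟩⟩
  -- No relation variables and no parameters are left: the prefix is `[]`, and the empty environment
  -- is admissible.
  · obtain ⟨Y, hY, hp, -⟩ := h.sound M (fun _ => Set.univ) (fun _ _ => False)
      (fun X => X.elim0) (fun X => X.elim0)
    exact hp [] a (H _ hY) _ (Set.mem_univ _)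
  · exact (h.complete M Y hY Fin.elim0 (fun X => X.elim0) (fun X => X.elim0) (fun X => X.elim0)
      a).1 H

/-! ### Definability in FO(LFP) -/

/-- The query `Q` is definable in FO(LFP), with relation variables `Δ` of which those in `O` occur
only positively, and the others not at all. -/
def LFPDefinable (L : FirstOrder.Language.{u, v}) (Δ : List ℕ) (n : ℕ) (O : Set (Fin Δ.length))
    (Q : ∀ (M : Type w) [Finite M] [Nonempty M] [L.Structure M],
      LFPExpr.Env Δ M → (Fin n → M) → Prop) : Prop :=
  ∃ e : LFPExpr L Δ n, e.WellFormed ∧ (∀ b X, (b = true ∨ X ∉ O) → e.Polarity b X) ∧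
    ∀ (M : Type w) [Finite M] [Nonempty M] [L.Structure M] (ρ : LFPExpr.Env Δ M) (a : Fin n → M),
      e.Realize ρ a ↔ Q M ρ a

namespace LFPDefinable

variable {L : FirstOrder.Language.{u, v}} {Δ : List ℕ} {n : ℕ} {O : Set (Fin Δ.length)}
  {Q Q' : ∀ (M : Type w) [Finite M] [Nonempty M] [L.Structure M],
    LFPExpr.Env Δ M → (Fin n → M) → Prop}

theorem congr (h : LFPDefinable L Δ n O Q)
    (hQ : ∀ (M : Type w) [Finite M] [Nonempty M] [L.Structure M] ρ a, Q M ρ a ↔ Q' M ρ a) :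
    LFPDefinable L Δ n O Q' := by
  obtain ⟨e, he, hp, hr⟩ := h
  exact ⟨e, he, hp, fun M _ _ _ ρ a => (hr M ρ a).trans (hQ M ρ a)⟩

theorem weaken (h : LFPDefinable L Δ n ∅ Q) : LFPDefinable L Δ n O Q := by
  obtain ⟨e, he, hp, hr⟩ := h
  exact ⟨e, he, fun b X _ => hp b X (Or.inr id), hr⟩

theorem eq (t s : L.Term (Fin n)) :
    LFPDefinable.{u, v, w} L Δ n O fun _ _ _ _ _ a => t.realize a = s.realize a :=
  ⟨.eq t s, trivial, fun _ _ _ => trivial, fun _ _ _ _ _ _ => Iff.rfl⟩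

theorem rel {m : ℕ} (R : L.Relations m) (ts : Fin m → L.Term (Fin n)) :
    LFPDefinable.{u, v, w} L Δ n O
      fun _ _ _ _ _ a => Structure.RelMap R fun i => (ts i).realize a :=
  ⟨.rel R ts, trivial, fun _ _ _ => trivial, fun _ _ _ _ _ _ => Iff.rfl⟩

theorem var {X : Fin Δ.length} (hX : X ∈ O) (ts : Fin (Δ.get X) → L.Term (Fin n)) :
    LFPDefinable.{u, v, w} L Δ n O fun _ _ _ _ ρ a => (fun i => (ts i).realize a) ∈ ρ X := by
  refine ⟨.var X ts, trivial, ?_, fun _ _ _ _ _ _ => Iff.rfl⟩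
  rintro b _ h rfl
  exact h.resolve_right fun h => h hX

/-- With `∅` no relation variable occurs, so negation cannot spoil positivity. -/
theorem not (h : LFPDefinable L Δ n ∅ Q) :
    LFPDefinable L Δ n O fun M _ _ _ ρ a => ¬ Q M ρ a := by
  obtain ⟨e, he, hp, hr⟩ := h
  exact ⟨e.neg, he, fun b X _ => hp (!b) X (Or.inr id), fun M _ _ _ ρ a => not_congr (hr M ρ a)⟩

theorem or (h : LFPDefinable L Δ n O Q) (h' : LFPDefinable L Δ n O Q') :
    LFPDefinable L Δ n O fun M _ _ _ ρ a => Q M ρ a ∨ Q' M ρ a := by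
  obtain ⟨e, he, hp, hr⟩ := h
  obtain ⟨e', he', hp', hr'⟩ := h'
  exact ⟨e.or e', ⟨he, he'⟩, fun b X h => ⟨hp b X h, hp' b X h⟩,
    fun M _ _ _ ρ a => or_congr (hr M ρ a) (hr' M ρ a)⟩

theorem and (h : LFPDefinable L Δ n O Q) (h' : LFPDefinable L Δ n O Q') :
    LFPDefinable L Δ n O fun M _ _ _ ρ a => Q M ρ a ∧ Q' M ρ a := by
  obtain ⟨e, he, hp, hr⟩ := h
  obtain ⟨e', he', hp', hr'⟩ := h'
  refine ⟨(e.neg.or e'.neg).neg, ⟨he, he'⟩, fun b X h => ?_, fun M _ _ _ ρ a => ?_⟩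
  · simpa [LFPExpr.Polarity] using And.intro (hp b X h) (hp' b X h)
  · simp [LFPExpr.Realize, hr, hr']

theorem imp (h : LFPDefinable L Δ n ∅ Q) (h' : LFPDefinable L Δ n O Q') :
    LFPDefinable L Δ n O fun M _ _ _ ρ a => Q M ρ a → Q' M ρ a :=
  (h.not.or h').congr fun _ _ _ _ _ _ => imp_iff_not_or.symm

theorem ex {Q : ∀ (M : Type w) [Finite M] [Nonempty M] [L.Structure M],
    LFPExpr.Env Δ M → (Fin (n + 1) → M) → Prop} (h : LFPDefinable L Δ (n + 1) O Q) :
    LFPDefinable L Δ n O fun M _ _ _ ρ a => ∃ b : M, Q M ρ (Fin.snoc a b) := by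
  obtain ⟨e, he, hp, hr⟩ := h
  exact ⟨e.ex, he, hp, fun M _ _ _ ρ a => exists_congr fun b => hr M ρ _⟩

theorem all {Q : ∀ (M : Type w) [Finite M] [Nonempty M] [L.Structure M],
    LFPExpr.Env Δ M → (Fin (n + 1) → M) → Prop} (h : LFPDefinable L Δ (n + 1) O Q) :
    LFPDefinable L Δ n O fun M _ _ _ ρ a => ∀ b : M, Q M ρ (Fin.snoc a b) := by
  obtain ⟨e, he, hp, hr⟩ := h
  refine ⟨e.neg.ex.neg, he, fun b X h => ?_, fun M _ _ _ ρ a => ?_⟩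
  · simpa [LFPExpr.Polarity] using hp b X h
  · simp [LFPExpr.Realize, hr]

theorem true : LFPDefinable.{u, v, w} L Δ n O fun _ _ _ _ _ _ => True :=
  (ex (eq (Term.var (Fin.last n)) (Term.var (Fin.last n)))).congr fun M _ _ _ _ _ =>
    iff_of_true ⟨Classical.arbitrary M, rfl⟩ trivial

theorem false : LFPDefinable.{u, v, w} L Δ n O fun _ _ _ _ _ _ => False :=
  (not true).congr fun _ _ _ _ _ _ => not_true

theorem forall_mem_list {α : Type*} (l : List α)
    {Q : α → ∀ (M : Type w) [Finite M] [Nonempty M] [L.Structure M],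
      LFPExpr.Env Δ M → (Fin n → M) → Prop} (h : ∀ x ∈ l, LFPDefinable L Δ n O (Q x)) :
    LFPDefinable L Δ n O fun M _ _ _ ρ a => ∀ x ∈ l, Q x M ρ a := by
  induction l with
  | nil => exact true.congr fun _ _ _ _ _ _ => by simp
  | cons x l ih =>
    rw [List.forall_mem_cons] at h
    exact (h.1.and (ih h.2)).congr fun _ _ _ _ _ _ => by rw [List.forall_mem_cons]

theorem exists_mem_list {α : Type*} (l : List α)
    {Q : α → ∀ (M : Type w) [Finite M] [Nonempty M] [L.Structure M],
      LFPExpr.Env Δ M → (Fin n → M) → Prop} (h : ∀ x ∈ l, LFPDefinable L Δ n O (Q x)) :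
    LFPDefinable L Δ n O fun M _ _ _ ρ a => ∃ x ∈ l, Q x M ρ a := by
  induction l with
  | nil => exact false.congr fun _ _ _ _ _ _ => by simp
  | cons x l ih =>
    rw [List.forall_mem_cons] at h
    exact (h.1.or (ih h.2)).congr fun _ _ _ _ _ _ => by simp

theorem forall_fin {k : ℕ} {Q : Fin k → ∀ (M : Type w) [Finite M] [Nonempty M] [L.Structure M],
      LFPExpr.Env Δ M → (Fin n → M) → Prop} (h : ∀ i, LFPDefinable L Δ n O (Q i)) :
    LFPDefinable L Δ n O fun M _ _ _ ρ a => ∀ i, Q i M ρ a :=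
  (forall_mem_list (List.finRange k) fun i _ => h i).congr fun _ _ _ _ _ _ => by simp

theorem append_zero {M : Type w} (a : Fin (n + 0) → M) (b : Fin 0 → M) : Fin.append a b = a :=
  funext fun i => Fin.append_left a b i

theorem exTuple {k : ℕ} {Q : ∀ (M : Type w) [Finite M] [Nonempty M] [L.Structure M],
    LFPExpr.Env Δ M → (Fin (n + k) → M) → Prop} (h : LFPDefinable L Δ (n + k) O Q) :
    LFPDefinable L Δ n O fun M _ _ _ ρ a => ∃ b : Fin k → M, Q M ρ (Fin.append a b) := by
  induction k with
  | zero => exact h.congr fun M _ _ _ ρ a => by simp [append_zero]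
  | succ k ih =>
    refine (ih (ex h)).congr fun M _ _ _ ρ a => ?_
    constructor
    · rintro ⟨b, c, h⟩
      exact ⟨Fin.snoc b c, by rwa [Fin.append_snoc]⟩
    · rintro ⟨b, h⟩
      exact ⟨Fin.init b, b (Fin.last k), by rwa [← Fin.append_snoc, Fin.snoc_init_self]⟩

theorem allTuple {k : ℕ} {Q : ∀ (M : Type w) [Finite M] [Nonempty M] [L.Structure M],
    LFPExpr.Env Δ M → (Fin (n + k) → M) → Prop} (h : LFPDefinable L Δ (n + k) O Q) :
    LFPDefinable L Δ n O fun M _ _ _ ρ a => ∀ b : Fin k → M, Q M ρ (Fin.append a b) := by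
  induction k with
  | zero => exact h.congr fun M _ _ _ ρ a => by simp [append_zero]
  | succ k ih =>
    refine (ih (all h)).congr fun M _ _ _ ρ a => ?_
    constructor
    · intro h b
      rw [← Fin.snoc_init_self b, Fin.append_snoc]
      exact h _ _
    · intro h b c
      rw [← Fin.append_snoc]
      exact h _

theorem lfp {m : ℕ} {O' : Set (Fin (m :: Δ).length)}
    {Q : ∀ (M : Type w) [Finite M] [Nonempty M] [L.Structure M],
      LFPExpr.Env (m :: Δ) M → (Fin (n + m) → M) → Prop}
    (h : LFPDefinable L (m :: Δ) (n + m) O' Q)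
    (hO : ∀ X : Fin Δ.length, (X.succ : Fin (Δ.length + 1)) ∈ O' → X ∈ O)
    (ts : Fin m → L.Term (Fin n)) :
    LFPDefinable L Δ n O fun M _ _ _ ρ a => (fun i => (ts i).realize a) ∈
      ⋂₀ {S | {b | Q M (LFPExpr.Env.cons S ρ) (Fin.append a b)} ⊆ S} := by
  obtain ⟨e, he, hp, hr⟩ := h
  refine ⟨.lfp e ts, ⟨hp _ _ (Or.inl rfl), he⟩, fun b X h => hp b _ (h.imp_right (mt (hO X))),
    fun M _ _ _ ρ a => ?_⟩
  simp only [LFPExpr.Realize, hr]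

end LFPDefinable

/-! ### From programs to FO(LFP) -/

/-- The `L'`-structures `st M` are definable in FO(LFP) from the `L`-structures `M`. -/
structure LFPInterpretation (L L' : FirstOrder.Language.{u, v})
    (st : ∀ (M : Type w) [Finite M] [Nonempty M] [L.Structure M], L'.Structure M) : Prop where
  term : ∀ {α : Type} (t : L'.Term α), ∃ t' : L.Term α,
    ∀ (M : Type w) [Finite M] [Nonempty M] [L.Structure M] (s : α → M),
      t'.realize s = letI := st M; t.realize s
  rel : ∀ {m : ℕ} (R : L'.Relations m) (Δ : List ℕ) (n : ℕ) (ts : Fin m → L.Term (Fin n)),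
    LFPDefinable L Δ n ∅ fun M _ _ _ _ a =>
      letI := st M; Structure.RelMap R fun i => (ts i).realize a

/-- Valuations of program variables are infinite sequences; a bound on the variables that matter
lets a finite block of quantifiers replace the quantifier over valuations. -/
theorem exists_realize_bound {L : FirstOrder.Language.{u, v}} (t : L.Term ℕ) :
    ∃ N, ∀ (M : Type w) [L.Structure M] (s s' : ℕ → M), (∀ i < N, s i = s' i) →
      t.realize s = t.realize s' := by
  induction t with
  | var i => exact ⟨i + 1, fun M _ s s' h => h i (Nat.lt_succ_self i)⟩
  | func f ts ih =>
    choose N hN using ih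
    refine ⟨Finset.univ.sup N, fun M _ s s' h => ?_⟩
    simp only [Term.realize]
    congr 1
    ext i
    exact hN i M s s' fun j hj => h j (hj.trans_le (Finset.le_sup (Finset.mem_univ i)))

theorem exists_holds_bound {L : FirstOrder.Language.{u, v}} {k : ℕ} {ar : Fin k → ℕ}
    (l : Literal L ar) :
    ∃ N, ∀ (M : Type w) [L.Structure M] (X : Interp ar M) (s s' : ℕ → M),
      (∀ i < N, s i = s' i) → (l.Holds X s ↔ l.Holds X s') := by
  have tuple : ∀ {m : ℕ} (ts : Fin m → L.Term ℕ), ∃ N, ∀ (M : Type w) [L.Structure M]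
      (s s' : ℕ → M), (∀ i < N, s i = s' i) → ∀ j, (ts j).realize s = (ts j).realize s' := by
    intro m ts
    choose N hN using fun j => exists_realize_bound.{u, v, w} (ts j)
    exact ⟨Finset.univ.sup N, fun M _ s s' h j =>
      hN j M s s' fun i hi => h i (hi.trans_le (Finset.le_sup (Finset.mem_univ j)))⟩
  cases l with
  | eq t t' =>
    obtain ⟨N, hN⟩ := tuple ![t, t']
    refine ⟨N, fun M _ X s s' h => ?_⟩
    have h0 := hN M s s' h 0
    have h1 := hN M s s' h 1
    simp only [Matrix.cons_val_zero, Matrix.cons_val_one] at h0 h1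
    simp only [Literal.Holds, h0, h1]
  | neq t t' =>
    obtain ⟨N, hN⟩ := tuple ![t, t']
    refine ⟨N, fun M _ X s s' h => ?_⟩
    have h0 := hN M s s' h 0
    have h1 := hN M s s' h 1
    simp only [Matrix.cons_val_zero, Matrix.cons_val_one] at h0 h1
    simp only [Literal.Holds, h0, h1]
  | rel R ts =>
    obtain ⟨N, hN⟩ := tuple ts
    exact ⟨N, fun M _ X s s' h => by simp only [Literal.Holds, hN M s s' h]⟩
  | nrel R ts =>
    obtain ⟨N, hN⟩ := tuple ts
    exact ⟨N, fun M _ X s s' h => by simp only [Literal.Holds, hN M s s' h]⟩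
  | int P ts =>
    obtain ⟨N, hN⟩ := tuple ts
    exact ⟨N, fun M _ X s s' h => by simp only [Literal.Holds, hN M s s' h]⟩
  | allInt P ts =>
    obtain ⟨N, hN⟩ := tuple fun i => (ts i).getD (Term.var 0)
    refine ⟨N, fun M _ X s s' h => ?_⟩
    simp only [Literal.Holds]
    refine forall_congr' fun b => imp_congr_left ?_
    refine forall_congr' fun i => forall_congr' fun t => imp_congr_right fun hi => ?_
    have := hN M s s' h i
    simp only [hi, Option.getD_some] at this
    rw [this]

/-! ### Rule bodies and the step operator in FO(LFP) -/

section Interpretation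

variable {L L' : FirstOrder.Language.{u, v}}
  {st : ∀ (M : Type w) [Finite M] [Nonempty M] [L.Structure M], L'.Structure M}
  {k : ℕ} {ar : Fin k → ℕ} {Δ : List ℕ} {O : Set (Fin Δ.length)}
  {X : ∀ (M : Type w) [Finite M] [Nonempty M] [L.Structure M], LFPExpr.Env Δ M → Interp ar M}

theorem LFPInterpretation.eq (I : LFPInterpretation L L' st) {n : ℕ} (t t' : L'.Term (Fin n)) :
    LFPDefinable L Δ n O fun M _ _ _ _ a => letI := st M; t.realize a = t'.realize a := by
  obtain ⟨r, hr⟩ := I.term t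
  obtain ⟨r', hr'⟩ := I.term t'
  exact (LFPDefinable.eq r r').congr fun M _ _ _ ρ a => by rw [hr, hr']

theorem LFPInterpretation.relMap (I : LFPInterpretation L L' st) {n m : ℕ} (R : L'.Relations m) (ts : Fin m → L'.Term (Fin n)) :
    LFPDefinable L Δ n ∅ fun M _ _ _ _ a =>
      letI := st M; Structure.RelMap R fun i => (ts i).realize a := by
  choose r hr using fun i => I.term (ts i)
  exact (I.rel R Δ n r).congr fun M _ _ _ ρ a => by simp only [hr]

theorem LFPInterpretation.holds (I : LFPInterpretation L L' st)
    (hX : ∀ (P : Fin k) (n : ℕ) (ts : Fin (ar P) → L.Term (Fin n)),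
      LFPDefinable L Δ n O fun M _ _ _ ρ a =>
        (⟨P, fun i => (ts i).realize a⟩ : Σ P : Fin k, Fin (ar P) → M) ∈ X M ρ)
    {n : ℕ} (f : ℕ → Fin n) (l : Literal L' ar) :
    LFPDefinable L Δ n O fun M _ _ _ ρ a => letI := st M; l.Holds (X M ρ) (a ∘ f) := by
  have hX' : ∀ (P : Fin k) (n : ℕ) (ts : Fin (ar P) → L'.Term (Fin n)),
      LFPDefinable L Δ n O fun M _ _ _ ρ a => letI := st M;
        (⟨P, fun i => (ts i).realize a⟩ : Σ P : Fin k, Fin (ar P) → M) ∈ X M ρ := by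
    intro P n ts
    choose r hr using fun i => I.term (ts i)
    exact (hX P n r).congr fun M _ _ _ ρ a => by simp only [hr]
  cases l with
  | eq t t' =>
    exact (I.eq (t.relabel f) (t'.relabel f)).congr fun M _ _ _ ρ a => by
      simp only [Term.realize_relabel, Literal.Holds]
  | neq t t' =>
    exact (I.eq (t.relabel f) (t'.relabel f)).not.congr fun M _ _ _ ρ a => by
      simp only [Term.realize_relabel, Literal.Holds, ne_eq]
  | rel R ts =>
    exact (I.relMap R fun i => (ts i).relabel f).weaken.congr fun M _ _ _ ρ a => by
      simp only [Term.realize_relabel, Literal.Holds]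
  | nrel R ts =>
    exact (I.relMap R fun i => (ts i).relabel f).not.congr fun M _ _ _ ρ a => by
      simp only [Term.realize_relabel, Literal.Holds]
  | int P ts =>
    exact (hX' P n fun i => (ts i).relabel f).congr fun M _ _ _ ρ a => by
      simp only [Term.realize_relabel, Literal.Holds]
  | allInt P ts =>
    -- All positions are quantified and the prescribed ones are pinned by equations. These form the
    -- premise of an implication, so they must not contain relation variables.
    have hc : ∀ i, LFPDefinable L Δ (n + ar P) ∅ fun M _ _ _ _ a => letI := st M;
        ∀ t, ts i = some t → a (Fin.natAdd n i) = t.realize (a ∘ Fin.castAdd (ar P) ∘ f) := by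
      intro i
      cases hi : ts i with
      | none => exact LFPDefinable.true.congr fun M _ _ _ ρ a => by simp
      | some t =>
        exact (I.eq (Term.var (Fin.natAdd n i)) (t.relabel (Fin.castAdd (ar P) ∘ f))).congr
          fun M _ _ _ ρ a => by simp
    exact (((LFPDefinable.forall_fin hc).imp
      (hX P (n + ar P) fun i => Term.var (Fin.natAdd n i))).allTuple).congr
      fun M _ _ _ ρ a => by
        have (b : Fin (ar P) → M) : Fin.append a b ∘ Fin.castAdd (ar P) ∘ f = a ∘ f := by
          ext i
          simp
        simp only [Literal.Holds, Fin.append_right, Term.realize_var, this]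

theorem LFPInterpretation.step (I : LFPInterpretation L L' st) (Pi : Program L')
    {X : ∀ (M : Type w) [Finite M] [Nonempty M] [L.Structure M], LFPExpr.Env Δ M → Interp Pi.ar M}
    (hX : ∀ (P : Fin Pi.k) (n : ℕ) (ts : Fin (Pi.ar P) → L.Term (Fin n)),
      LFPDefinable L Δ n O fun M _ _ _ ρ a =>
        (⟨P, fun i => (ts i).realize a⟩ : Σ P : Fin Pi.k, Fin (Pi.ar P) → M) ∈ X M ρ)
    {n : ℕ} (P : Fin Pi.k) (f : Fin (Pi.ar P) → Fin n) :
    LFPDefinable L Δ n O fun M _ _ _ ρ a => letI := st M;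
      (⟨P, a ∘ f⟩ : Σ P : Fin Pi.k, Fin (Pi.ar P) → M) ∈ Pi.step M (X M ρ) := by
  refine LFPDefinable.exists_mem_list Pi.rules (Q := fun r M _ _ _ ρ a => letI := st M;
    ∃ s : ℕ → M, (∀ l ∈ r.body, l.Holds (X M ρ) s) ∧
      (⟨P, a ∘ f⟩ : Σ P : Fin Pi.k, Fin (Pi.ar P) → M) =
        ⟨r.head, fun i => (r.headArgs i).realize s⟩) fun r _ => ?_
  by_cases hP : r.head = P
  swap
  · refine LFPDefinable.false.congr fun M _ _ _ ρ a => ?_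
    simp only [false_iff]
    rintro ⟨s, -, h⟩
    exact hP (congrArg Sigma.fst h).symm
  subst hP
  choose B hB using fun l : Literal L' Pi.ar => exists_holds_bound.{u, v, w} l
  choose B' hB' using fun i => exists_realize_bound.{u, v, w} (r.headArgs i)
  -- Exceeds all variables that matter in the rule; the `+ 1` provides the index `0` to which `g`
  -- sends the irrelevant variables.
  set N := (r.body.map B).sum + Finset.univ.sup B' + 1 with hN
  let g : ℕ → Fin (n + N) := fun i => Fin.natAdd n (if h : i < N then ⟨i, h⟩ else ⟨0, by omega⟩)
  have h1 : ∀ l ∈ r.body, LFPDefinable L Δ (n + N) O fun M _ _ _ ρ a => letI := st M;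
      l.Holds (X M ρ) (a ∘ g) := fun l _ => I.holds hX g l
  have h2 : ∀ i, LFPDefinable L Δ (n + N) O fun M _ _ _ _ a => letI := st M;
      a (Fin.castAdd N (f i)) = (r.headArgs i).realize (a ∘ g) := fun i =>
    (I.eq (Term.var (Fin.castAdd N (f i))) ((r.headArgs i).relabel g)).congr
      fun M _ _ _ ρ a => by simp only [Term.realize_relabel, Term.realize_var]
  refine ((LFPDefinable.forall_mem_list _ h1).and (LFPDefinable.forall_fin h2)).exTuple.congr ?_
  intro M _ _ _ ρ a
  let := st M
  constructor
  · rintro ⟨b, hl, hh⟩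
    refine ⟨Fin.append a b ∘ g, hl, ?_⟩
    congr 1
    ext i
    simpa using hh i
  · rintro ⟨s, hl, hh⟩
    refine ⟨fun i => s i, ?_⟩
    have hs : ∀ i < N, s i = (Fin.append a (fun i : Fin N => s i) ∘ g) i := by
      intro i hi
      simp only [g, hi, Function.comp_apply, dif_pos, Fin.append_right]
    constructor
    · intro l hlr
      refine (hB l M _ s _ fun i hi => hs i (hi.trans_le ?_)).1 (hl l hlr)
      have := List.single_le_sum (by simp) _ (List.mem_map_of_mem (f := B) hlr)
      omega
    · intro i
      have := congrFun (eq_of_heq (Sigma.mk.inj hh).2) i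
      simp only [Function.comp_apply] at this
      rw [Fin.append_left, this]
      refine hB' i M s _ fun j hj => hs j (hj.trans_le ?_)
      have := Finset.le_sup (f := B') (Finset.mem_univ i)
      omega

end Interpretation

/-! ### Simultaneous least fixed points by nested ones -/

namespace Program

variable {L : FirstOrder.Language.{u, v}} (Pi : Program L) (M : Type w) [L.Structure M]

/-- The least interpretation that contains `B` and is closed under the rules for the symbols outside
`O`. -/
def relLimit (O : Set (Fin Pi.k)) (B : Interp Pi.ar M) : Interp Pi.ar M :=
  ⋂₀ {Y | B ⊆ Y ∧ ∀ x ∈ Pi.step M Y, x.1 ∉ O → x ∈ Y}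

variable {Pi M} {O : Set (Fin Pi.k)} {B : Interp Pi.ar M}

theorem subset_relLimit : B ⊆ Pi.relLimit M O B := Set.subset_sInter fun _ hY => hY.1

theorem mem_relLimit_of_mem_step {x : Σ P : Fin Pi.k, Fin (Pi.ar P) → M}
    (h : x ∈ Pi.step M (Pi.relLimit M O B)) (hx : x.1 ∉ O) : x ∈ Pi.relLimit M O B :=
  fun _ hY => hY.2 x (Pi.step_mono M (Set.sInter_subset_of_mem hY) h) hx

theorem relLimit_subset {Y : Interp Pi.ar M} (h : B ⊆ Y)
    (h' : ∀ x ∈ Pi.step M Y, x.1 ∉ O → x ∈ Y) : Pi.relLimit M O B ⊆ Y :=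
  Set.sInter_subset_of_mem ⟨h, h'⟩

/-- No rule for a symbol in `O` is applied, so the set that puts no restriction on the other symbols
is already closed. -/
theorem mem_relLimit_iff {x : Σ P : Fin Pi.k, Fin (Pi.ar P) → M} (hx : x.1 ∈ O) :
    x ∈ Pi.relLimit M O B ↔ x ∈ B :=
  ⟨fun h => relLimit_subset (Y := {y | y.1 ∈ O → y ∈ B}) (fun _ hy _ => hy)
    (fun _ _ hy hy' => absurd hy' hy) h hx, fun h => subset_relLimit h⟩

theorem relLimit_empty [Finite M] : Pi.relLimit M ∅ ∅ = Pi.limit M := by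
  refine (relLimit_subset (Set.empty_subset _)
    fun x hx _ => Pi.step_limit_subset M hx).antisymm ?_
  exact Pi.limit_subset_of_step_subset M fun x hx => mem_relLimit_of_mem_step hx id

/-- One component of a simultaneous least fixed point is the least fixed point of the operator that
takes the least fixed point of the other components. -/
theorem mem_relLimit_iff_mem_lfp (hB : ∀ x ∈ B, x.1 ∈ O) {P : Fin Pi.k} (hP : P ∉ O)
    {t : Fin (Pi.ar P) → M} :
    (⟨P, t⟩ : Σ P : Fin Pi.k, Fin (Pi.ar P) → M) ∈ Pi.relLimit M O B ↔
      t ∈ ⋂₀ {S | {b | (⟨P, b⟩ : Σ P : Fin Pi.k, Fin (Pi.ar P) → M) ∈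
        Pi.step M (Pi.relLimit M (insert P O) (B ∪ Sigma.mk P '' S))} ⊆ S} := by
  constructor
  -- If `S` is closed under the operator, the inner limit built over `S` is closed under the rules
  -- for `P` as well, so it contains the outer limit.
  · intro h S hS
    have hmem : ∀ b : Fin (Pi.ar P) → M, (⟨P, b⟩ : Σ P : Fin Pi.k, Fin (Pi.ar P) → M) ∈
        Pi.relLimit M (insert P O) (B ∪ Sigma.mk P '' S) ↔ b ∈ S := by
      intro b
      rw [mem_relLimit_iff (Set.mem_insert P O)]
      constructor
      · rintro (h | ⟨c, hc, h⟩)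
        · exact absurd (hB _ h) hP
        · obtain rfl := eq_of_heq (Sigma.mk.inj h).2
          exact hc
      · exact fun h => Or.inr ⟨b, h, rfl⟩
    refine (hmem t).1 (relLimit_subset (Set.subset_union_left.trans subset_relLimit) ?_ h)
    rintro ⟨Q, b⟩ hx hQ
    by_cases hQP : Q = P
    · subst hQP
      exact (hmem b).2 (hS hx)
    · exact mem_relLimit_of_mem_step hx fun h => h.elim hQP hQ
  · intro h
    -- Conversely, the `P`-component of the outer limit is closed under the operator, because the
    -- inner limit built over it stays inside the outer one.
    refine h {b | (⟨P, b⟩ : Σ P : Fin Pi.k, Fin (Pi.ar P) → M) ∈ Pi.relLimit M O B} ?_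
    intro b hb
    refine mem_relLimit_of_mem_step (Pi.step_mono M (relLimit_subset ?_ ?_) hb) hP
    · rintro x (hx | ⟨c, hc, rfl⟩)
      · exact subset_relLimit hx
      · exact hc
    · exact fun x hx hxO => mem_relLimit_of_mem_step hx fun h => hxO (Set.mem_insert_of_mem P h)

end Program

section Open

variable {k : ℕ} {ar : Fin k → ℕ}

/-- An assignment of relation variables in `Δ` to some of the intentional symbols. -/
abbrev VarAssignment (ar : Fin k → ℕ) (Δ : List ℕ) : Type :=
  (P : Fin k) → Option {X : Fin Δ.length // Δ.get X = ar P}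

namespace VarAssignment

variable {Δ : List ℕ} (σ : VarAssignment ar Δ)

/-- The symbols that have a relation variable. -/
def dom : Set (Fin k) := {P | σ P ≠ none}

/-- The relation variables that are used. -/
def range : Set (Fin Δ.length) := {X | ∃ P h, σ P = some ⟨X, h⟩}

/-- The values of the symbols that have a relation variable. -/
def facts {M : Type w} (ρ : LFPExpr.Env Δ M) : Interp ar M :=
  {x | ∃ X h, σ x.1 = some ⟨X, h⟩ ∧ (fun i => x.2 (Fin.cast h i)) ∈ ρ X}

/-- Assign a new first relation variable to `P`. -/
def cons (P : Fin k) : VarAssignment ar (ar P :: Δ) := fun Q =>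
  if h : P = Q then some ⟨(0 : Fin (Δ.length + 1)), congrArg ar h⟩
  else (σ Q).map fun X => ⟨(X.1.succ : Fin (Δ.length + 1)), X.2⟩

variable {σ}

theorem fst_mem_dom_of_mem_facts {M : Type w} {ρ : LFPExpr.Env Δ M}
    {x : Σ P : Fin k, Fin (ar P) → M} (h : x ∈ σ.facts ρ) : x.1 ∈ σ.dom := by
  obtain ⟨X, hX, h, -⟩ := h
  simp [dom, h]

theorem dom_cons (P : Fin k) : (σ.cons P).dom = insert P σ.dom := by
  ext Q
  by_cases h : P = Q
  · simp [dom, cons, h]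
  · simp [dom, cons, h, Ne.symm h]

theorem mem_range_of_succ_mem_range_cons {P : Fin k} {X : Fin Δ.length}
    (h : (X.succ : Fin (Δ.length + 1)) ∈ (σ.cons P).range) : X ∈ σ.range := by
  obtain ⟨Q, h, hQ⟩ := h
  unfold cons at hQ
  split_ifs at hQ with hPQ
  · exact absurd (congrArg Subtype.val (Option.some.inj hQ)).symm (Fin.succ_ne_zero X)
  · obtain ⟨⟨Y, hY⟩, hs, hYX⟩ := Option.map_eq_some_iff.1 hQ
    obtain rfl : Y = X := Fin.succ_injective _ (congrArg Subtype.val hYX)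
    exact ⟨Q, hY, hs⟩

theorem facts_cons {P : Fin k} (hP : P ∉ σ.dom) {M : Type w} (ρ : LFPExpr.Env Δ M)
    (S : Set (Fin (ar P) → M)) :
    (σ.cons P).facts (LFPExpr.Env.cons S ρ) = σ.facts ρ ∪ Sigma.mk P '' S := by
  ext ⟨Q, b⟩
  constructor
  · rintro ⟨X, h, hX, hb⟩
    unfold cons at hX
    dsimp only at hX
    split_ifs at hX with hPQ
    · subst hPQ
      obtain rfl := (congrArg Subtype.val (Option.some.inj hX))
      exact Or.inr ⟨b, hb, rfl⟩
    · obtain ⟨⟨Y, hY⟩, hs, hYX⟩ := Option.map_eq_some_iff.1 hX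
      obtain rfl := congrArg Subtype.val hYX
      exact Or.inl ⟨Y, hY, hs, hb⟩
  · rintro (⟨X, h, hX, hb⟩ | ⟨c, hc, h⟩)
    · have hPQ : P ≠ Q := by
        rintro rfl
        exact hP (by simp only [dom] at *; exact fun h' => by simp [h'] at hX)
      refine ⟨(X.succ : Fin (Δ.length + 1)), h, ?_, hb⟩
      dsimp only at hX
      simp [cons, hPQ, hX]
    · obtain rfl := (Sigma.mk.inj h).1
      obtain rfl := eq_of_heq (Sigma.mk.inj h).2
      exact ⟨(0 : Fin (Δ.length + 1)), rfl, by simp [cons], hc⟩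

end VarAssignment

variable {L L' : FirstOrder.Language.{u, v}}
  {st : ∀ (M : Type w) [Finite M] [Nonempty M] [L.Structure M], L'.Structure M}

theorem relLimit_of_mem_dom (Pi : Program L') {Δ : List ℕ} (σ : VarAssignment Pi.ar Δ)
    {P : Fin Pi.k} (hP : P ∈ σ.dom) {n : ℕ} (ts : Fin (Pi.ar P) → L.Term (Fin n)) :
    LFPDefinable L Δ n σ.range fun M _ _ _ ρ a => letI := st M;
      (⟨P, fun i => (ts i).realize a⟩ : Σ P : Fin Pi.k, Fin (Pi.ar P) → M) ∈
        Pi.relLimit M σ.dom (σ.facts ρ) := by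
  obtain ⟨⟨X, h⟩, hX⟩ := Option.ne_none_iff_exists'.1 hP
  refine (LFPDefinable.var (O := σ.range) (X := X) ⟨P, h, hX⟩ fun i => ts (Fin.cast h i)).congr
    fun M _ _ _ ρ a => ?_
  rw [Program.mem_relLimit_iff hP]
  constructor
  · exact fun H => ⟨X, h, hX, H⟩
  · rintro ⟨Y, h', hY, H⟩
    obtain rfl : Y = X := congrArg Subtype.val (Option.some.inj (hY.symm.trans hX))
    exact H

/-- Induction on the number of symbols without a relation variable. To define such a `P`, it is
given a new variable; the induction hypothesis defines all symbols relative to it, one step of the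
rules gives the operator for `P`, and its least fixed point is the desired component. -/
theorem LFPInterpretation.relLimit (I : LFPInterpretation L L' st) (Pi : Program L') {c : ℕ}
    {Δ : List ℕ} (σ : VarAssignment Pi.ar Δ) (hc : σ.domᶜ.ncard = c) (P : Fin Pi.k) {n : ℕ}
    (ts : Fin (Pi.ar P) → L.Term (Fin n)) :
    LFPDefinable L Δ n σ.range fun M _ _ _ ρ a => letI := st M;
      (⟨P, fun i => (ts i).realize a⟩ : Σ P : Fin Pi.k, Fin (Pi.ar P) → M) ∈
        Pi.relLimit M σ.dom (σ.facts ρ) := by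
  induction c generalizing Δ P n with
  | zero =>
    have hP : P ∈ σ.dom := by
      by_contra h
      exact (Set.ncard_pos (Set.toFinite _)).2 ⟨P, h⟩ |>.ne' hc
    exact relLimit_of_mem_dom Pi σ hP ts
  | succ c ih =>
    by_cases hP : P ∈ σ.dom
    · exact relLimit_of_mem_dom Pi σ hP ts
    · have hc' : (σ.cons P).domᶜ.ncard = c := by
        have : insert P (σ.cons P).domᶜ = σ.domᶜ := by
          rw [VarAssignment.dom_cons]
          ext Q
          by_cases h : Q = P <;> simp [h, hP]
        rw [← this, Set.ncard_insert_of_notMem (by simp [VarAssignment.dom_cons])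
          (Set.toFinite _)] at hc
        omega
      have hstep := I.step Pi (fun Q n ts => ih (σ.cons P) hc' Q ts) P
        (fun i => Fin.natAdd n i)
      refine (hstep.lfp (O := σ.range)
        (fun X hX => VarAssignment.mem_range_of_succ_mem_range_cons hX) ts).congr
        fun M _ _ _ ρ a => ?_
      rw [Program.mem_relLimit_iff_mem_lfp
        (fun x hx => VarAssignment.fst_mem_dom_of_mem_facts hx) hP]
      simp only [VarAssignment.dom_cons, VarAssignment.facts_cons hP]
      have (b : Fin (Pi.ar P) → M) : (Fin.append a b ∘ fun i => Fin.natAdd n i) = b := by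
        ext i
        simp
      simp only [this]

theorem LFPInterpretation.limit (I : LFPInterpretation L L' st) (Pi : Program L') (Δ : List ℕ)
    (P : Fin Pi.k) {n : ℕ} (ts : Fin (Pi.ar P) → L.Term (Fin n)) :
    LFPDefinable L Δ n ∅ fun M _ _ _ _ a => letI := st M;
      (⟨P, fun i => (ts i).realize a⟩ : Σ P : Fin Pi.k, Fin (Pi.ar P) → M) ∈ Pi.limit M := by
  let σ : VarAssignment Pi.ar Δ := fun _ => none
  have h := I.relLimit Pi σ rfl P ts
  have hr : σ.range = ∅ := by
    ext X
    simp [σ, VarAssignment.range]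
  rw [hr] at h
  refine h.congr fun M _ _ _ ρ a => ?_
  have hd : σ.dom = ∅ := by
    ext X
    simp [σ, VarAssignment.dom]
  have hf : σ.facts ρ = ∅ := by
    ext X
    simp [σ, VarAssignment.facts]
  rw [hd, hf, Program.relLimit_empty]

/-- A program adds no function symbols, so terms keep their translations, and the new relations are
definable without free relation variables. -/
theorem LFPInterpretation.expansion (I : LFPInterpretation L L' st) (Pi : Program L') :
    LFPInterpretation L Pi.lang fun M _ _ _ => letI := st M; Pi.expansion M where
  term t := by
    induction t with
    | var x => exact ⟨Term.var x, fun M _ _ _ s => rfl⟩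
    | @func l f ts ih =>
      rcases f with f | f
      · choose r hr using ih
        -- The function symbol is translated on distinct variables, and the translated arguments are
        -- substituted afterwards.
        obtain ⟨t', ht'⟩ := I.term (Term.func f fun i : Fin l => Term.var i)
        refine ⟨t'.subst r, fun M _ _ _ s => ?_⟩
        rw [Term.realize_subst, ht']
        simp only [Term.realize, hr]
        rfl
      · exact Empty.elim f
  rel R Δ n ts := by
    rcases R with R | ⟨P, rfl⟩
    · exact I.rel R Δ n ts
    · exact I.limit Pi Δ P ts

/-- The base language `L` stays fixed while `L'` grows with each stratum, so every stratum is
defined directly over the original structure. -/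
theorem LFPInterpretation.value (I : LFPInterpretation L L' st) {S : StratProgram L'} (P : S.Sym)
    (Δ : List ℕ) {n : ℕ} (ts : Fin P.ar → L.Term (Fin n)) :
    LFPDefinable L Δ n ∅ fun M _ _ _ _ a => letI := st M;
      (fun i => (ts i).realize a) ∈ P.value M := by
  induction P with
  | @single L' Pi P => exact I.limit Pi Δ P ts
  | @first L' Pi S P => exact I.limit Pi Δ P ts
  | @later L' Pi S P ih => exact ih (I.expansion Pi) ts

end Open

/-- On finite structures, every S-DATALOG^r formula is equivalent to an FO(LFP) formula. -/
theorem StratFormula.exists_lfpFormula {L : FirstOrder.Language.{u, v}} {n : ℕ}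
    (φ : StratFormula L n) :
    ∃ ψ : LFPFormula L n, ∀ (M : Type w) [Finite M] [Nonempty M] [L.Structure M]
      (a : Fin n → M), φ.Realize M a ↔ ψ.Realize M a := by
  have I : LFPInterpretation.{u, v, w} L L fun M _ _ i => i :=
    ⟨fun t => ⟨t, fun M _ _ _ s => rfl⟩, fun R Δ n ts => LFPDefinable.rel R ts⟩
  obtain ⟨e, he, -, hr⟩ := I.value φ.sym [] fun i => Term.var (φ.args i)
  exact ⟨⟨e, he⟩, fun M _ _ _ a => (hr M _ a).symm⟩

end DatalogLFP

theorem mainTheorem2 (L : FirstOrder.Language.{u, v})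
    (hL : DatalogLFP.IsVocabulary L) (n : ℕ) :
    DatalogLFP.SameExpressivePower.{u, v, w} L n
      (fun (φ : DatalogLFP.DatalogFormula L n) M _ a => φ.Realize M a)
      (fun (ψ : DatalogLFP.StratFormula L n) M _ a => ψ.Realize M a) ∧
    DatalogLFP.SameExpressivePower.{u, v, w} L n
      (fun (φ : DatalogLFP.StratFormula L n) M _ a => φ.Realize M a)
      (fun (ψ : DatalogLFP.LFPFormula L n) M _ a => ψ.Realize M a) := by
  have toStrat : ∀ φ : DatalogLFP.DatalogFormula L n, ∃ ψ : DatalogLFP.StratFormula L n,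
      ∀ (M : Type w) [Finite M] [Nonempty M] [L.Structure M] (a : Fin n → M),
        φ.Realize M a ↔ ψ.Realize M a := fun φ =>
    ⟨⟨.single φ.prog, .single φ.sym, φ.args⟩, fun M _ _ _ a => Iff.rfl⟩
  refine ⟨⟨toStrat, fun ψ => ?_⟩, fun φ => φ.exists_lfpFormula, fun ψ => ?_⟩
  -- Strata are collapsed to one by a detour through FO(LFP).
  · obtain ⟨χ, hχ⟩ := ψ.exists_lfpFormula
    obtain ⟨φ, hφ⟩ := χ.exists_datalogFormula
    exact ⟨φ, fun M _ _ _ a => (hφ M a).trans (hχ M a).symm⟩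
  · obtain ⟨χ, hχ⟩ := ψ.exists_datalogFormula
    obtain ⟨φ, hφ⟩ := toStrat χ
    exact ⟨φ, fun M _ _ _ a => (hφ M a).symm.trans (hχ M a)⟩
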